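/- Let $T$ be a once-punctured torus with a complete hyperbolic structure for which the puncture is a cusp, let $p:\mathbb H\to T$ be its universal covering, and let $\rho:F_2=\langle a,b\rangle\cong\pi_1(T)\to \mathrm{PSL}(2,\mathbb R)$ be its (injective) holonomy, where $a,b$ are standard free generators, so that $[a,b]$ is represented by a loop around the puncture. Let $\mathrm{PSL}(2,\mathbb R)$ act on $\mathbb{RP}^1$ and let $\mathbb R\to\mathbb{RP}^1$ be the universal covering, with deck group generated by $x\mapsto x+1$. Then: 1. $F_2$ is locally indicable: every nontrivial finitely generated subgroup admits a surjective homomorphism to $\mathbb Z$. 2. $\rho([a,b])$ has exactly one fixed point $\xi\in\mathbb{RP}^1$, and there is an action $\tilde\rho$ of $F_2$ on $\mathbb R$ by homeomorphisms which lifts the action of $\rho$ on $\mathbb{RP}^1$ and for which both $\tilde\rho(a)$ and $\tilde\rho(b)$ have fixed points. 3. Let $\tilde\rho$ be any such lift. Every $\tilde\rho(g)$ is increasing and commutes with $x\mapsto x+1$. There is $c\in\{[a,b],[b,a]\}$ (so $c=[a,b]$ after interchanging $a$ and $b$ if necessary) such that $\tilde\rho(c)(\tilde p)=\tilde p+1$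 for every lift $\tilde p\in\mathbb R$ of $\xi$, and $\tilde\rho(c^n)(z)>z+n-1$ for all $z\in\mathbb R$ and all integers $n\ge 1$. For every lift $\tilde p$ of $\xi$, both $\tilde\rho(a)$ and $\tilde\rho(b)$ have fixed points strictly between $\tilde p$ and $\tilde p+1$. 4. Let $j:\mathbb R\to I=[0,1]$ be any increasing homeomorphism onto $(0,1)$. Then $\tilde\rho$ extends through $j$ to a faithful action $\sigma$ of $F_2$ on $I$ by orientation-preserving homeomorphisms, $\sigma(g)(j(t))=j(\tilde\rho(g)(t))$. For every lift $\tilde p$ of $\xi$, the points $p_n=j(\tilde p+n)$, $n\in\mathbb Z$, satisfy $p_n\to 1$ as $n\to+\infty$, $\sigma(c)(p_n)=p_{n+1}$, and $\sigma(h)(p_n)<\sigma(c^2)(p_n)$ for $h\in\{a,a^{-1},b,b^{-1}\}$ and all $n\in\mathbb Z$. The action $\sigma$ is not topologically conjugate into $\mathrm{Diff}^1_+(I)$: there is no homeomorphism $\varphi$ of $I$ such that $\varphi\,\sigma(g)\,\varphi^{-1}$ is an orientation-preserving $C^1$ diffeomorphism of $I$ for every $g\in F_2$. -/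

import Mathlib

open scoped LinearAlgebra.Projectivization UpperHalfPlane unitInterval Topology

noncomputable section

/-! ### The surface and its holonomy -/

/-- The once-punctured torus `(ℝ/ℤ)² ∖ {0}`. -/
abbrev PuncturedTorus : Type := {x : UnitAddCircle × UnitAddCircle // x ≠ 0}

/-- `PSL(2, ℝ)`. -/
abbrev PSL2R : Type := Matrix.ProjectiveSpecialLinearGroup (Fin 2) ℝ

/-- The free group of rank two, with free generators `genA` and `genB`. -/
abbrev F2 : Type := FreeGroup (Fin 2)

/-- The generator `a`. -/
def genA : F2 := FreeGroup.of 0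

/-- The generator `b`. -/
def genB : F2 := FreeGroup.of 1

/-- The commutator `[g, h]`. -/
def commF2 (g h : F2) : F2 := g * h * g⁻¹ * h⁻¹

/-- The action of `PSL(2, ℝ)` on the hyperbolic plane by orientation-preserving isometries
(Möbius transformations of the upper half-plane). -/
def moebius (γ : PSL2R) (z : ℍ) : ℍ := Matrix.ProjectiveSpecialLinearGroup.toPGL γ • z

/-- The open horoball `M • {Im > 1}`; every open horoball of `ℍ` is of this form. -/
def horoball (M : Matrix.SpecialLinearGroup (Fin 2) ℝ) : Set ℍ := {z | 1 < (M⁻¹ • z).im}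

/-- `p : ℍ → PuncturedTorus` is the universal covering of a (complete) hyperbolic structure on the
once-punctured torus for which the puncture is a cusp, and `ρ` is the holonomy of this structure
with respect to the standard generators `a`, `b` of the fundamental group. -/
structure IsCuspedTorusHolonomy (p : ℍ → PuncturedTorus) (ρ : F2 →* PSL2R) : Prop where
  covering : IsCoveringMap p
  surjective : Function.Surjective p
  /-- The deck group of `p` is the image of `ρ`, so the hyperbolic metric of `ℍ` descends. -/
  fiber : ∀ z w : ℍ, p z = p w ↔ ∃ g : F2, moebius (ρ g) z = w
  /-- `ρ` identifies the fundamental group, free on `a` and `b`, with the deck group of `p`. -/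
  injective : Function.Injective ρ
  /-- `[a, b]` is peripheral: it is freely homotopic to loops arbitrarily close to the puncture. -/
  peripheral : ∀ U ∈ 𝓝 (0 : UnitAddCircle × UnitAddCircle),
    ∃ z : ℍ, JoinedIn {w : ℍ | (p w : UnitAddCircle × UnitAddCircle) ∈ U} z
      (moebius (ρ (commF2 genA genB)) z)
  /-- The puncture is a cusp: it has a punctured neighbourhood which is the quotient of a horoball
  `B` by a group of parabolic translations, namely by all those deck transformations which do not
  move `B` off itself. -/
  cusp : ∃ M : Matrix.SpecialLinearGroup (Fin 2) ℝ, ∃ U ∈ 𝓝 (0 : UnitAddCircle × UnitAddCircle),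
    (∀ z : ℍ, (p z : UnitAddCircle × UnitAddCircle) ∈ U ↔
      ∃ g : F2, moebius (ρ g) z ∈ horoball M) ∧
    ∀ g : F2, (∃ z ∈ horoball M, moebius (ρ g) z ∈ horoball M) →
      ∃ t : ℝ, ∀ z : ℍ, M⁻¹ • moebius (ρ g) z = t +ᵥ (M⁻¹ • z)

/-! ### Lifting to the universal cover of the projective line -/

/-- The universal covering `ℝ → ℝP¹`, `t ↦ [cos πt : sin πt]`, with deck group generated by
`t ↦ t + 1`. -/
def coverRP1 (t : ℝ) : ℙ ℝ (Fin 2 → ℝ) :=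
  Projectivization.mk ℝ ![Real.cos (Real.pi * t), Real.sin (Real.pi * t)] (by
    intro h
    have h0 : Real.cos (Real.pi * t) = 0 := congrFun h 0
    have h1 : Real.sin (Real.pi * t) = 0 := congrFun h 1
    have h2 := Real.sin_sq_add_cos_sq (Real.pi * t)
    simp [h0, h1] at h2)

/-- `τ` is an action on `ℝ` by homeomorphisms lifting the action on `ℝP¹` given by `ρ`. -/
def IsLiftedAction (ρ : F2 →* PSL2R) (τ : F2 →* (ℝ ≃ₜ ℝ)) : Prop :=
  ∀ (g : F2) (t : ℝ), coverRP1 (τ g t) = ρ g • coverRP1 t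

/-! ### Actions on the interval -/

/-- `f` is an orientation-preserving `C¹` diffeomorphism of the closed interval `I = [0, 1]`
(with one-sided derivatives at the endpoints). -/
def IsC1Diffeo (f : I ≃ₜ I) : Prop :=
  StrictMono f ∧
  ContDiffOn ℝ 1 (Set.IccExtend zero_le_one fun x : I => (f x : ℝ)) (Set.Icc 0 1) ∧
  ContDiffOn ℝ 1 (Set.IccExtend zero_le_one fun x : I => (f.symm x : ℝ)) (Set.Icc 0 1)

/-- The action `α` is topologically conjugate into the group of orientation-preserving `C¹`
diffeomorphisms of `I`. -/
def IsConjIntoDiff1 {G : Type*} [Group G] (α : G →* (I ≃ₜ I)) : Prop :=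
  ∃ φ : I ≃ₜ I, ∀ g : G, IsC1Diffeo (φ * α g * φ⁻¹)

/-- The order `g <_x h` on a group acting on `I` which is determined by the point `x`. -/
def OrbitLT {G : Type*} [Group G] (α : G →* (I ≃ₜ I)) (x : I) (g h : G) : Prop :=
  α g x < α h x

/-- Every nontrivial finitely generated subgroup admits a surjective homomorphism to `ℤ`. -/
def LocallyIndicable (G : Type*) [Group G] : Prop :=
  ∀ H : Subgroup G, H.FG → H ≠ ⊥ → ∃ f : H →* Multiplicative ℤ, Function.Surjective f

/-- `j` includes `ℝ` in `I` as the interior, preserving orientation. -/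
def IsInteriorInclusion (j : ℝ → I) : Prop :=
  Continuous j ∧ StrictMono j ∧ Set.range j = Set.Ioo 0 1

end

/-! Local indicability is Nielsen–Schreier. The rest rests on the translation number of the lifted
commutator. Deck transformations act freely on ℍ, so no nontrivial element is elliptic
(`four_le_trace_sq`), and the generators have lifts to ℝ with fixed points. The cusp makes `ρ [a,
b]` parabolic (`exists_eq_parabolic`) with a single fixed point ξ, so any lifted action moves the
lifts of ξ by a fixed integer n under [a, b].

A degree one map with a fixed point moves every point by less than 1. As [a, b] = a · (b a b⁻¹)⁻¹ is
a product of two such maps, |n| < 2. If n were 0, the matrix commutator [A, B] would have a positive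
eigenvalue, hence trace 2. By `commute_conj_of_trace_commutator_eq_two`, [A, B] would then commute
with its conjugate by A, which fails in a free group (`commF2_apply_ne_self`). So n = ±1, and c is
[a, b] or its inverse.

Near the endpoint 1 of the interval both generators have fixed points accumulating. After
conjugation to C¹ maps their derivatives at the limit are 1, so their displacements have arbitrarily
small Lipschitz constant there, and a commutator moves points much less than the generators do
(`eventually_commutator_sq_eq`). But at the points p_n, c² moves further than a, b and their
inverses. This is an order relation, so it survives conjugation and contradicts smoothness
(`not_isConjIntoDiff1_of_orbitLT`). -/

/-! ### Free groups. -/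

theorem IsFreeGroup.exists_surjective_int (G : Type*) [Group G] [IsFreeGroup G] [Nontrivial G] :
    ∃ f : G →* Multiplicative ℤ, Function.Surjective f := by
  have hne : Nonempty (IsFreeGroup.Generators G) := by
    by_contra h
    rw [not_nonempty_iff] at h
    have := (IsFreeGroup.toFreeGroup G).toEquiv.nontrivial_congr.1 inferInstance
    exact not_subsingleton (FreeGroup (IsFreeGroup.Generators G)) inferInstance
  obtain ⟨x⟩ := hne
  let f : G →* Multiplicative ℤ := IsFreeGroup.lift fun _ => Multiplicative.ofAdd 1
  refine ⟨f, fun n => ⟨IsFreeGroup.of x ^ n.toAdd, ?_⟩⟩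
  rw [map_zpow, IsFreeGroup.lift_of, ← ofAdd_zsmul]
  simp

/-- Nielsen–Schreier enters through the instance making a subgroup of a free group free. -/
theorem locallyIndicable_F2 : LocallyIndicable F2 := by
  intro H _ hH
  have : Nontrivial H := (Subgroup.nontrivial_iff_ne_bot H).2 hH
  exact IsFreeGroup.exists_surjective_int H

theorem commF2_gen_ne_one : commF2 genA genB ≠ 1 := by
  unfold commF2 genA genB
  decide

/-- Decided by comparing reduced words. This is the fact contradicted if the lifted commutator has a
fixed point. -/
theorem not_commute_commF2_conj :
    ¬ Commute (commF2 genA genB) (genA * commF2 genA genB * genA⁻¹) := by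
  unfold Commute SemiconjBy commF2 genA genB
  decide

/-! ### The covering `ℝ → ℝP¹` -/

/-- The unit vector spanning `coverRP1 t`. -/
noncomputable def angleVec (t : ℝ) : Fin 2 → ℝ := ![Real.cos (Real.pi * t), Real.sin (Real.pi * t)]

theorem angleVec_ne_zero (t : ℝ) : angleVec t ≠ 0 := by
  intro h
  have h0 : Real.cos (Real.pi * t) = 0 := congrFun h 0
  have h1 : Real.sin (Real.pi * t) = 0 := congrFun h 1
  have h2 := Real.sin_sq_add_cos_sq (Real.pi * t)
  simp [h0, h1] at h2

theorem coverRP1_eq_mk (t : ℝ) :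
    coverRP1 t = Projectivization.mk ℝ (angleVec t) (angleVec_ne_zero t) := rfl

theorem coverRP1_eq_iff_sin {x y : ℝ} :
    coverRP1 x = coverRP1 y ↔ Real.sin (Real.pi * (y - x)) = 0 := by
  rw [coverRP1_eq_mk, coverRP1_eq_mk, Projectivization.mk_eq_mk_iff', mul_sub, Real.sin_sub]
  constructor
  · rintro ⟨k, hk⟩
    have h0 : k * Real.cos (Real.pi * y) = Real.cos (Real.pi * x) := congrFun hk 0
    have h1 : k * Real.sin (Real.pi * y) = Real.sin (Real.pi * x) := congrFun hk 1
    rw [← h0, ← h1]; ring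
  · intro h
    -- For parallel unit vectors the proportionality factor is their inner product.
    refine ⟨Real.cos (Real.pi * y) * Real.cos (Real.pi * x) +
      Real.sin (Real.pi * y) * Real.sin (Real.pi * x), ?_⟩
    have hy := Real.sin_sq_add_cos_sq (Real.pi * y)
    ext i
    fin_cases i
    · simp only [angleVec, Pi.smul_apply, smul_eq_mul, Fin.zero_eta, Matrix.cons_val_zero]
      linear_combination (-Real.sin (Real.pi * y)) * h + Real.cos (Real.pi * x) * hy
    · simp only [angleVec, Pi.smul_apply, smul_eq_mul, Fin.mk_one, Matrix.cons_val_one,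
        Matrix.cons_val_fin_one]
      linear_combination (Real.cos (Real.pi * y)) * h + Real.sin (Real.pi * x) * hy

theorem coverRP1_eq_iff {x y : ℝ} : coverRP1 x = coverRP1 y ↔ ∃ n : ℤ, y = x + n := by
  rw [coverRP1_eq_iff_sin, Real.sin_eq_zero_iff]
  refine exists_congr fun n => ?_
  rw [mul_comm, mul_right_inj' Real.pi_ne_zero, eq_sub_iff_add_eq, add_comm, eq_comm]

theorem coverRP1_add_intCast (x : ℝ) (n : ℤ) : coverRP1 (x + n) = coverRP1 x :=
  (coverRP1_eq_iff.2 ⟨n, rfl⟩).symm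

theorem coverRP1_surjective : Function.Surjective coverRP1 := by
  intro η
  induction η using Projectivization.ind with
  | _ v hv =>
    let z : ℂ := ⟨v 0, v 1⟩
    refine ⟨z.arg / Real.pi, ?_⟩
    have hz : ‖z‖ ≠ 0 := by
      intro h
      rw [norm_eq_zero] at h
      apply hv
      ext i
      fin_cases i
      · exact congrArg Complex.re h
      · exact congrArg Complex.im h
    rw [coverRP1_eq_mk, Projectivization.mk_eq_mk_iff']
    refine ⟨‖z‖⁻¹, ?_⟩
    have hpi : Real.pi * (z.arg / Real.pi) = z.arg := by field_simp
    have h0 : v 0 = ‖z‖ * Real.cos z.arg := (Complex.norm_mul_cos_arg z).symm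
    have h1 : v 1 = ‖z‖ * Real.sin z.arg := (Complex.norm_mul_sin_arg z).symm
    ext i
    fin_cases i
    · simp only [angleVec, hpi, Pi.smul_apply, smul_eq_mul, Fin.zero_eta, Matrix.cons_val_zero]
      rw [h0]; field_simp
    · simp only [angleVec, hpi, Pi.smul_apply, smul_eq_mul, Fin.mk_one, Matrix.cons_val_one,
        Matrix.cons_val_fin_one]
      rw [h1]; field_simp

/-! ### Continuous lifts of projective transformations. -/

theorem psl_smul_coverRP1_eq_iff (A : Matrix.SpecialLinearGroup (Fin 2) ℝ) (s t : ℝ) :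
    coverRP1 s = (A : PSL2R) • coverRP1 t ↔
      ∃ r : ℝ, r ≠ 0 ∧ A.1.mulVec (angleVec t) = r • angleVec s := by
  rw [eq_comm, Matrix.ProjectiveSpecialLinearGroup.smul_proj_mk, coverRP1_eq_mk, coverRP1_eq_mk,
    Projectivization.smul_mk, Projectivization.mk_eq_mk_iff]
  constructor
  · rintro ⟨r, hr⟩
    exact ⟨r, r.ne_zero, hr.symm⟩
  · rintro ⟨r, hr0, hr⟩
    exact ⟨Units.mk0 r hr0, hr.symm⟩

/-- `f` covers the projective transformation `A`, stretching by a positive factor. -/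
def CoversPos (A : Matrix.SpecialLinearGroup (Fin 2) ℝ) (f : ℝ → ℝ) : Prop :=
  ∀ t, ∃ r : ℝ, 0 < r ∧ A.1.mulVec (angleVec t) = r • angleVec (f t)

theorem continuous_angleVec : Continuous angleVec := by
  unfold angleVec
  fun_prop

theorem angleVec_dotProduct_self (t : ℝ) : angleVec t ⬝ᵥ angleVec t = 1 := by
  have := Real.sin_sq_add_cos_sq (Real.pi * t)
  simp only [angleVec, dotProduct, Fin.sum_univ_two, Matrix.cons_val_zero, Matrix.cons_val_one,
    Matrix.cons_val_fin_one]
  linarith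

theorem angleVec_neg_mulVec (A : Matrix.SpecialLinearGroup (Fin 2) ℝ) (v : Fin 2 → ℝ) :
    (-A).1.mulVec v = - A.1.mulVec v := by
  rw [← Matrix.neg_mulVec]; rfl

/-- The stretching factor is the inner product of `A v(t)` with `v(f t)`, hence continuous. It never
vanishes, so its sign is constant and can be absorbed into the matrix. A lift thus selects one of
the two matrices ±A. -/
theorem exists_coversPos_of_continuous {f : ℝ → ℝ} (hf : Continuous f)
    (A : Matrix.SpecialLinearGroup (Fin 2) ℝ)
    (h : ∀ t, coverRP1 (f t) = (A : PSL2R) • coverRP1 t) :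
    CoversPos A f ∨ CoversPos (-A) f := by
  simp only [psl_smul_coverRP1_eq_iff] at h
  choose r hr0 hr using h
  have hrc : Continuous r := by
    have : r = fun t => A.1.mulVec (angleVec t) ⬝ᵥ angleVec (f t) := by
      ext t
      rw [hr, smul_dotProduct, angleVec_dotProduct_self, smul_eq_mul, mul_one]
    rw [this]
    have h1 := continuous_angleVec
    have h2 := continuous_angleVec.comp hf
    exact (Continuous.matrix_mulVec continuous_const h1).dotProduct h2
  rcases lt_or_gt_of_ne (hr0 0) with h0 | h0
  · right
    intro t
    refine ⟨- r t, ?_, by rw [angleVec_neg_mulVec, hr, neg_smul]⟩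
    by_contra hle
    obtain ⟨s, hs⟩ := mem_range_of_exists_le_of_exists_ge hrc ⟨0, h0.le⟩ ⟨t, by linarith⟩
    exact hr0 s hs
  · left
    intro t
    refine ⟨r t, ?_, hr t⟩
    by_contra hle
    obtain ⟨s, hs⟩ := mem_range_of_exists_le_of_exists_ge hrc ⟨t, not_lt.1 hle⟩ ⟨0, h0.le⟩
    exact hr0 s hs

theorem CoversPos.coverRP1_eq {A : Matrix.SpecialLinearGroup (Fin 2) ℝ} {f : ℝ → ℝ}
    (h : CoversPos A f) (t : ℝ) : coverRP1 (f t) = (A : PSL2R) • coverRP1 t := by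
  obtain ⟨r, hr0, hr⟩ := h t
  exact (psl_smul_coverRP1_eq_iff _ _ _).2 ⟨r, hr0.ne', hr⟩

theorem CoversPos.mul {A B : Matrix.SpecialLinearGroup (Fin 2) ℝ} {f g : ℝ → ℝ}
    (hA : CoversPos A f) (hB : CoversPos B g) : CoversPos (A * B) (f ∘ g) := by
  intro t
  obtain ⟨r, hr0, hr⟩ := hB t
  obtain ⟨s, hs0, hs⟩ := hA (g t)
  refine ⟨r * s, mul_pos hr0 hs0, ?_⟩
  rw [Matrix.SpecialLinearGroup.coe_mul, ← Matrix.mulVec_mulVec, hr, Matrix.mulVec_smul, hs,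
    smul_smul, Function.comp_apply]

theorem CoversPos.symm {A : Matrix.SpecialLinearGroup (Fin 2) ℝ} {f : ℝ ≃ ℝ}
    (hA : CoversPos A f) : CoversPos A⁻¹ f.symm := by
  intro t
  obtain ⟨r, hr0, hr⟩ := hA (f.symm t)
  refine ⟨r⁻¹, inv_pos.2 hr0, ?_⟩
  have h1 : (A⁻¹).1.mulVec (A.1.mulVec (angleVec (f.symm t))) = angleVec (f.symm t) := by
    rw [Matrix.mulVec_mulVec, ← Matrix.SpecialLinearGroup.coe_mul, inv_mul_cancel]
    simp
  rw [hr, Equiv.apply_symm_apply, Matrix.mulVec_smul] at h1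
  rw [← h1, smul_smul, inv_mul_cancel₀ hr0.ne', one_smul]

theorem sin_pi_sub_eq_det (s t : ℝ) : Real.sin (Real.pi * (t - s)) =
    angleVec s 0 * angleVec t 1 - angleVec s 1 * angleVec t 0 := by
  simp only [angleVec, Matrix.cons_val_zero, Matrix.cons_val_one, Matrix.cons_val_fin_one]
  rw [mul_sub, Real.sin_sub]; ring

/-- The sine is the area spanned by two unit vectors. A matrix of determinant 1 preserves area, and
the stretching factors are positive. -/
theorem CoversPos.sin_pos_iff {A : Matrix.SpecialLinearGroup (Fin 2) ℝ} {f : ℝ → ℝ}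
    (hA : CoversPos A f) (s t : ℝ) :
    0 < Real.sin (Real.pi * (f t - f s)) ↔ 0 < Real.sin (Real.pi * (t - s)) := by
  obtain ⟨r, hr0, hr⟩ := hA s
  obtain ⟨q, hq0, hq⟩ := hA t
  have hr1 := congrFun hr 0
  have hr2 := congrFun hr 1
  have hq1 := congrFun hq 0
  have hq2 := congrFun hq 1
  have hdet := A.2
  simp only [Matrix.mulVec, dotProduct, Fin.sum_univ_two, Pi.smul_apply, smul_eq_mul]
    at hr1 hr2 hq1 hq2
  rw [Matrix.det_fin_two] at hdet
  have key : Real.sin (Real.pi * (t - s)) = r * q * Real.sin (Real.pi * (f t - f s)) := by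
    rw [sin_pi_sub_eq_det, sin_pi_sub_eq_det]
    calc _ = (A.1 0 0 * A.1 1 1 - A.1 0 1 * A.1 1 0) *
          (angleVec s 0 * angleVec t 1 - angleVec s 1 * angleVec t 0) := by rw [hdet, one_mul]
      _ = (r * angleVec (f s) 0) * (q * angleVec (f t) 1) -
          (r * angleVec (f s) 1) * (q * angleVec (f t) 0) := by
        rw [← hr1, ← hr2, ← hq1, ← hq2]; ring
      _ = _ := by ring
  rw [key, mul_pos_iff_of_pos_left (mul_pos hr0 hq0)]

/-- As u runs from s to t, `f u - f s` starts at 0 and the sine of π times it is positive once u >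
s. By continuity it can neither become negative nor reach 1. -/
theorem CoversPos.sub_mem_Ioo {A : Matrix.SpecialLinearGroup (Fin 2) ℝ} {f : ℝ → ℝ}
    (hA : CoversPos A f) (hf : Continuous f) {s t : ℝ} (hst : s < t) (hts : t < s + 1) :
    0 < f t - f s ∧ f t - f s < 1 := by
  have hpi := Real.pi_pos
  have hpos : ∀ u, s < u → u ≤ t → 0 < Real.sin (Real.pi * (f u - f s)) := by
    intro u hu hut
    rw [hA.sin_pos_iff]
    apply Real.sin_pos_of_pos_of_lt_pi
    · apply mul_pos hpi; linarith
    · nlinarith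
  have hc : ContinuousOn (fun u => f u - f s) (Set.Icc s t) := by fun_prop
  constructor
  · by_contra hle
    have hneg : f t - f s < 0 := by
      rcases (not_lt.1 hle).lt_or_eq with h | h
      · exact h
      · have := hpos t hst le_rfl
        simp [h] at this
    -- Truncating at -1/2 gives a value in (-1, 0), where the sine is certainly negative.
    obtain ⟨u, hu, hfu⟩ := intermediate_value_Icc' hst.le hc
      (show max (f t - f s) (-1 / 2) ∈ Set.Icc (f t - f s) (f s - f s) from
        ⟨le_max_left _ _, by simp only [sub_self, max_le_iff]; constructor <;> linarith⟩)
    have hlt : f u - f s < 0 := by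
      simp only at hfu; rw [hfu, max_lt_iff]; constructor <;> linarith
    have hgt : -1 / 2 ≤ f u - f s := by simp only at hfu; rw [hfu]; exact le_max_right _ _
    have hsu : s < u := by
      rcases hu.1.lt_or_eq with h | h
      · exact h
      · rw [h] at hlt; simp at hlt
    refine absurd (hpos u hsu hu.2) (not_lt.2 (Real.sin_neg_of_neg_of_neg_pi_lt ?_ ?_).le)
    · exact mul_neg_of_pos_of_neg hpi hlt
    · nlinarith
  · by_contra hle
    obtain ⟨u, hu, hfu⟩ := intermediate_value_Icc hst.le hc
      (show (1 : ℝ) ∈ Set.Icc (f s - f s) (f t - f s) from ⟨by simp, not_lt.1 hle⟩)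
    have hsu : s < u := by
      rcases hu.1.lt_or_eq with h | h
      · exact h
      · simp only at hfu; rw [h] at hfu; simp at hfu
    have := hpos u hsu hu.2
    simp only at hfu
    simp [hfu] at this

theorem CoversPos.strictMono {A : Matrix.SpecialLinearGroup (Fin 2) ℝ} {f : ℝ → ℝ}
    (hA : CoversPos A f) (hf : Continuous f) : StrictMono f := by
  -- Local monotonicity is chained in steps of 1/2, safely below the length 1 on which it is known.
  have key : ∀ (n : ℕ) (s t : ℝ), s < t → t < s + (n + 1) / 2 → f s < f t := by
    intro n
    induction n with
    | zero =>
      intro s t hst hts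
      have := (hA.sub_mem_Ioo hf hst (by norm_num at hts; linarith)).1
      linarith
    | succ n ih =>
      intro s t hst hts
      push_cast at hts
      rcases lt_or_ge t (s + 1) with h | h
      · have := (hA.sub_mem_Ioo hf hst h).1
        linarith
      · have h1 := (hA.sub_mem_Ioo hf (show s < s + 1 / 2 by linarith) (by linarith)).1
        have h2 := ih (s + 1 / 2) t (by linarith) (by linarith)
        linarith
  intro s t hst
  obtain ⟨n, hn⟩ := exists_nat_gt (2 * (t - s))
  exact key n s t hst (by linarith)

/-- The increment is an integer, and a sum of two half-step increments in (0, 1), so it is 1. -/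
theorem CoversPos.map_add_one {A : Matrix.SpecialLinearGroup (Fin 2) ℝ} {f : ℝ → ℝ}
    (hA : CoversPos A f) (hf : Continuous f) (t : ℝ) : f (t + 1) = f t + 1 := by
  have h1 : coverRP1 (f t) = coverRP1 (f (t + 1)) := by
    have h2 := coverRP1_add_intCast t 1
    push_cast at h2
    rw [hA.coverRP1_eq, hA.coverRP1_eq, h2]
  obtain ⟨n, hn⟩ := coverRP1_eq_iff.1 h1
  have hm := hA.strictMono hf (show t < t + 1 / 2 by linarith)
  have hm' := hA.strictMono hf (show t + 1 / 2 < t + 1 by linarith)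
  have a1 := (hA.sub_mem_Ioo hf (show t < t + 1 / 2 by linarith) (by linarith)).2
  have a2 := (hA.sub_mem_Ioo hf (show t + 1 / 2 < t + 1 by linarith) (by linarith)).2
  have b1 : (0 : ℝ) < n := by linarith
  have b2 : (n : ℝ) < 2 := by linarith
  have : n = 1 := by
    have c1 : 0 < n := by exact_mod_cast b1
    have c2 : n < 2 := by exact_mod_cast b2
    omega
  rw [hn, this]; norm_num

/-- A continuous map covering a projective transformation, as a degree one lift. -/
def CoversPos.toDegOne {A : Matrix.SpecialLinearGroup (Fin 2) ℝ} {f : ℝ → ℝ}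
    (hA : CoversPos A f) (hf : Continuous f) : CircleDeg1Lift where
  toFun := f
  monotone' := (hA.strictMono hf).monotone
  map_add_one' := hA.map_add_one hf

theorem CoversPos.map_add_intCast {A : Matrix.SpecialLinearGroup (Fin 2) ℝ} {f : ℝ → ℝ}
    (hA : CoversPos A f) (hf : Continuous f) (t : ℝ) (n : ℤ) : f (t + n) = f t + n :=
  (hA.toDegOne hf).map_add_int t n

theorem CoversPos.surjective {A : Matrix.SpecialLinearGroup (Fin 2) ℝ} {f : ℝ → ℝ}
    (hA : CoversPos A f) (hf : Continuous f) : Function.Surjective f := by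
  intro y
  obtain ⟨n, hn⟩ := exists_int_gt (y - f 0)
  obtain ⟨m, hm⟩ := exists_int_lt (y - f 0)
  refine mem_range_of_exists_le_of_exists_ge hf ⟨0 + m, ?_⟩ ⟨0 + n, ?_⟩
  · rw [hA.map_add_intCast hf]; linarith
  · rw [hA.map_add_intCast hf]; linarith

/-- A continuous map covering a projective transformation, as a homeomorphism. -/
noncomputable def CoversPos.toHomeomorph {A : Matrix.SpecialLinearGroup (Fin 2) ℝ} {f : ℝ → ℝ}
    (hA : CoversPos A f) (hf : Continuous f) : ℝ ≃ₜ ℝ :=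
  ((hA.strictMono hf).orderIsoOfSurjective f (hA.surjective hf)).toHomeomorph

theorem CoversPos.toHomeomorph_apply {A : Matrix.SpecialLinearGroup (Fin 2) ℝ} {f : ℝ → ℝ}
    (hA : CoversPos A f) (hf : Continuous f) (t : ℝ) : hA.toHomeomorph hf t = f t := rfl

/-- With ℝ² = ℂ, A acts by z ↦ αz + βz̄ and det A = |α|² - |β|² = 1, so |β/α| < 1. At z = e^{iπt}
the image is αz · w(t) with w(t) = 1 + (β/α)e^{-2πit}. Since w stays in the open unit disc about 1,
its principal argument is continuous, and the lift is t + (arg α + arg w(t))/π. -/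
theorem exists_continuous_coversPos (A : Matrix.SpecialLinearGroup (Fin 2) ℝ) :
    ∃ f : ℝ → ℝ, Continuous f ∧ CoversPos A f := by
  let α : ℂ := ⟨(A 0 0 + A 1 1) / 2, (A 1 0 - A 0 1) / 2⟩
  let β : ℂ := ⟨(A 0 0 - A 1 1) / 2, (A 1 0 + A 0 1) / 2⟩
  have hdet : A 0 0 * A 1 1 - A 0 1 * A 1 0 = 1 := by
    have := A.2
    rwa [Matrix.det_fin_two] at this
  have hnorm : ‖α‖ ^ 2 - ‖β‖ ^ 2 = 1 := by
    rw [Complex.sq_norm, Complex.sq_norm, Complex.normSq_apply, Complex.normSq_apply]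
    simp only [α, β]
    linear_combination hdet
  have hα : 0 < ‖α‖ := by
    rcases (norm_nonneg α).lt_or_eq with h | h
    · exact h
    · rw [← h] at hnorm; nlinarith [sq_nonneg ‖β‖]
  have hα0 : α ≠ 0 := norm_pos_iff.1 hα
  have hlt : ‖β / α‖ < 1 := by
    rw [norm_div, div_lt_one hα]
    nlinarith [norm_nonneg β]
  let e : ℝ → ℂ := fun t => Complex.exp ((Real.pi * t : ℝ) * Complex.I)
  let w : ℝ → ℂ := fun t => 1 + β / α * Complex.exp ((-2 * (Real.pi * t) : ℝ) * Complex.I)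
  have hwc : Continuous w := by
    simp only [w]
    fun_prop
  have hw : ∀ t, w t ∈ Complex.slitPlane := by
    intro t
    left
    have h1 : ‖β / α * Complex.exp ((-2 * (Real.pi * t) : ℝ) * Complex.I)‖ < 1 := by
      rw [norm_mul, Complex.norm_exp_ofReal_mul_I, mul_one]; exact hlt
    have h2 := (abs_lt.1 ((Complex.abs_re_le_norm _).trans_lt h1)).1
    simp only [w, Complex.add_re, Complex.one_re]
    linarith
  refine ⟨fun t => t + (α.arg + (w t).arg) / Real.pi, ?_, ?_⟩
  · refine continuous_id.add (Continuous.div_const (continuous_const.add ?_) _)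
    exact continuous_iff_continuousAt.2 fun t =>
      (Complex.continuousAt_arg (hw t)).comp hwc.continuousAt
  · intro t
    refine ⟨‖α‖ * ‖w t‖, mul_pos hα (norm_pos_iff.2 (Complex.slitPlane_ne_zero (hw t))), ?_⟩
    have hpi : Real.pi * (t + (α.arg + (w t).arg) / Real.pi) =
        Real.pi * t + α.arg + (w t).arg := by
      field_simp [Real.pi_ne_zero]
      ring
    have h1 : α * w t * e t = α * e t + β * (starRingEnd ℂ) (e t) := by
      have h2 : e t * Complex.exp ((-2 * (Real.pi * t) : ℝ) * Complex.I) =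
          (starRingEnd ℂ) (e t) := by
        simp only [e]
        rw [← Complex.exp_add, ← Complex.exp_conj]
        congr 1
        simp only [map_mul, Complex.conj_ofReal, Complex.conj_I]
        push_cast
        ring
      rw [← h2]
      simp only [w]
      field_simp
    have h3 : α * w t * e t = (‖α‖ * ‖w t‖ : ℝ) *
        Complex.exp ((Real.pi * (t + (α.arg + (w t).arg) / Real.pi) : ℝ) * Complex.I) := by
      rw [hpi]
      conv_lhs => rw [← Complex.norm_mul_exp_arg_mul_I α, ← Complex.norm_mul_exp_arg_mul_I (w t)]
      simp only [e]
      push_cast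
      rw [add_mul, add_mul, Complex.exp_add, Complex.exp_add]
      ring
    rw [h1] at h3
    have hre := congrArg Complex.re h3
    have him := congrArg Complex.im h3
    simp only [e, Complex.exp_ofReal_mul_I_re, Complex.exp_ofReal_mul_I_im, Complex.add_re,
      Complex.add_im, Complex.mul_re, Complex.mul_im, Complex.conj_re, Complex.conj_im,
      Complex.ofReal_re, Complex.ofReal_im, α, β] at hre him
    ext i
    fin_cases i
    · simp only [Matrix.mulVec, dotProduct, Fin.sum_univ_two, angleVec, Pi.smul_apply, smul_eq_mul,
        Fin.zero_eta, Matrix.cons_val_zero, Matrix.cons_val_one, Matrix.cons_val_fin_one]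
      simp only [α]
      linear_combination hre
    · simp only [Matrix.mulVec, dotProduct, Fin.sum_univ_two, angleVec, Pi.smul_apply, smul_eq_mul,
        Fin.mk_one, Matrix.cons_val_zero, Matrix.cons_val_one, Matrix.cons_val_fin_one]
      simp only [α]
      linear_combination him

/-! ### Lifts with fixed points. -/

theorem exists_smul_eq_self_of_four_le (A : Matrix.SpecialLinearGroup (Fin 2) ℝ)
    (h : 4 ≤ A.1.trace ^ 2) : ∃ η : ℙ ℝ (Fin 2 → ℝ), (A : PSL2R) • η = η := by
  have hdet := A.2
  rw [Matrix.det_fin_two] at hdet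
  rw [Matrix.trace_fin_two] at h
  have key : ∀ v : Fin 2 → ℝ, v ≠ 0 → ∀ k : ℝ, A.1.mulVec v = k • v →
      ∃ η : ℙ ℝ (Fin 2 → ℝ), (A : PSL2R) • η = η := by
    intro v hv k hk
    refine ⟨Projectivization.mk ℝ v hv, ?_⟩
    rw [Matrix.ProjectiveSpecialLinearGroup.smul_proj_mk, Projectivization.smul_mk,
      Projectivization.mk_eq_mk_iff']
    exact ⟨k, hk.symm⟩
  by_cases hc : A.1 1 0 = 0
  · refine key ![1, 0] (fun h0 => one_ne_zero (congrFun h0 0)) (A.1 0 0) ?_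
    ext i
    fin_cases i <;> simp [Matrix.mulVec, dotProduct, Fin.sum_univ_two, hc]
  · have hs := Real.sq_sqrt (show 0 ≤ (A.1 0 0 + A.1 1 1) ^ 2 - 4 by linarith)
    set s := √((A.1 0 0 + A.1 1 1) ^ 2 - 4)
    refine key ![(A.1 0 0 + A.1 1 1 + s) / 2 - A.1 1 1, A.1 1 0] (fun h0 => hc (congrFun h0 1))
      ((A.1 0 0 + A.1 1 1 + s) / 2) ?_
    ext i
    fin_cases i
    · simp only [Matrix.mulVec, dotProduct, Fin.sum_univ_two, Pi.smul_apply, smul_eq_mul,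
        Fin.zero_eta, Matrix.cons_val_zero, Matrix.cons_val_one, Matrix.cons_val_fin_one]
      linear_combination -hdet - hs / 4
    · simp only [Matrix.mulVec, dotProduct, Fin.sum_univ_two, Pi.smul_apply, smul_eq_mul,
        Fin.mk_one, Matrix.cons_val_zero, Matrix.cons_val_one, Matrix.cons_val_fin_one]
      ring

/-- Any lift moves a point over an eigendirection by an integer, which a deck translation corrects.
-/
theorem exists_lift_with_fixedPoint (A : Matrix.SpecialLinearGroup (Fin 2) ℝ)
    (h : 4 ≤ A.1.trace ^ 2) :
    ∃ f : ℝ ≃ₜ ℝ, (∀ t, coverRP1 (f t) = (A : PSL2R) • coverRP1 t) ∧ ∃ x, f x = x := by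
  obtain ⟨f, hf, hA⟩ := exists_continuous_coversPos A
  obtain ⟨η, hη⟩ := exists_smul_eq_self_of_four_le A h
  obtain ⟨x, rfl⟩ := coverRP1_surjective η
  rw [← hA.coverRP1_eq] at hη
  obtain ⟨n, hn⟩ := coverRP1_eq_iff.1 hη
  refine ⟨(hA.toHomeomorph hf).trans (Homeomorph.addRight (n : ℝ)), fun t => ?_, x, ?_⟩
  · simp only [Homeomorph.trans_apply, Homeomorph.coe_addRight, hA.toHomeomorph_apply,
      coverRP1_add_intCast, hA.coverRP1_eq]
  · simp only [Homeomorph.trans_apply, Homeomorph.coe_addRight, hA.toHomeomorph_apply, ← hn]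

/-! ### A criterion for commuting conjugates -/

/-- Over a field N has rank at most one, N = uvᵀ, so NXN = (vᵀXu)N. The entrywise computation works
over any commutative ring. -/
theorem Matrix.mul_mul_self_eq_trace_smul_of_nilpotent {R : Type*} [CommRing R]
    (N X : Matrix (Fin 2) (Fin 2) R) (ht : N.trace = 0) (hd : N.det = 0) :
    N * X * N = (N * X).trace • N := by
  rw [Matrix.trace_fin_two] at ht
  rw [Matrix.det_fin_two] at hd
  have h11 : N 1 1 = - N 0 0 := by linear_combination ht
  rw [h11] at hd
  ext i j
  fin_cases i <;> fin_cases j <;>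
    simp only [Matrix.mul_apply, Fin.sum_univ_two, Matrix.trace_fin_two, Matrix.smul_apply,
      smul_eq_mul, Fin.zero_eta, Fin.mk_one, h11]
  · linear_combination (-X 1 1) * hd
  · linear_combination (X 0 1) * hd
  · linear_combination (X 1 0) * hd
  · linear_combination (-X 0 0) * (hd)

/-- Write C = 1 + N with tr N = det N = 0. Once tr(NA) = 0, both NAN and NA⁻¹N vanish, so N and
ANA⁻¹ annihilate each other in either order and 1 + N commutes with 1 + ANA⁻¹. -/
theorem Matrix.SpecialLinearGroup.commute_conj_of_trace_commutator_eq_two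
    {R : Type*} [CommRing R] (A B : Matrix.SpecialLinearGroup (Fin 2) R)
    (h : (A * B * A⁻¹ * B⁻¹).1.trace = 2) :
    Commute (A * B * A⁻¹ * B⁻¹) (A * (A * B * A⁻¹ * B⁻¹) * A⁻¹) := by
  set C := A * B * A⁻¹ * B⁻¹ with hC
  have adj : ∀ M : Matrix.SpecialLinearGroup (Fin 2) R, M⁻¹.1 = M.1.trace • 1 - M.1 := by
    intro M
    rw [Matrix.SpecialLinearGroup.coe_inv, Matrix.adjugate_fin_two, Matrix.trace_fin_two]
    ext i j
    fin_cases i <;> fin_cases j <;> simp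
  set N := C.1 - 1 with hN
  have ht : N.trace = 0 := by
    rw [hN, Matrix.trace_sub, h, Matrix.trace_one]; norm_num
  have hd : N.det = 0 := by
    have h1 := C.2
    rw [Matrix.det_fin_two] at h1
    rw [Matrix.trace_fin_two] at h
    rw [hN, Matrix.det_fin_two]
    simp only [Matrix.sub_apply, Matrix.one_apply_eq, ne_eq, Fin.zero_ne_one, not_false_eq_true,
      Matrix.one_apply_ne, one_ne_zero]
    linear_combination h1 - h
  -- By cyclicity and A² = (tr A)A - 1, tr(CA) = tr A · tr C - tr(BA⁻¹B⁻¹) = 2 tr A - tr A.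
  have hCA : (C.1 * A.1).trace = A.1.trace := by
    have h1 : (C.1 * A.1).trace = (A.1 * A.1 * (B * A⁻¹ * B⁻¹).1).trace := by
      rw [Matrix.trace_mul_comm, ← Matrix.SpecialLinearGroup.coe_mul,
        ← Matrix.SpecialLinearGroup.coe_mul, ← Matrix.SpecialLinearGroup.coe_mul]
      congr 2
      simp only [hC, mul_assoc]
      rfl
    have h2 : A.1 * A.1 = A.1.trace • A.1 - 1 := by
      have h3 : A.1 * A⁻¹.1 = 1 := by
        rw [← Matrix.SpecialLinearGroup.coe_mul, mul_inv_cancel]; rfl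
      rw [adj, mul_sub, mul_smul_comm, mul_one] at h3
      rw [← h3]; abel
    have h4 : (B * A⁻¹ * B⁻¹).1.trace = A.1.trace := by
      rw [Matrix.SpecialLinearGroup.coe_mul, Matrix.trace_mul_comm,
        ← Matrix.SpecialLinearGroup.coe_mul, ← mul_assoc, inv_mul_cancel, one_mul, adj,
        Matrix.trace_sub, Matrix.trace_smul, Matrix.trace_one]
      simp only [Fintype.card_fin, smul_eq_mul]
      push_cast; ring
    have h5 : (A.1 * (B * A⁻¹ * B⁻¹).1).trace = 2 := by
      rw [← h, ← Matrix.SpecialLinearGroup.coe_mul]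
      congr 2
      simp only [hC, mul_assoc]
      rfl
    rw [h1, h2, Matrix.sub_mul, Matrix.trace_sub, smul_mul_assoc, Matrix.trace_smul, h5, one_mul,
      h4, smul_eq_mul]
    ring
  have hNA : (N * A.1).trace = 0 := by
    rw [hN, Matrix.sub_mul, Matrix.trace_sub, one_mul, hCA, sub_self]
  have hNAN : N * A.1 * N = 0 := by
    rw [Matrix.mul_mul_self_eq_trace_smul_of_nilpotent N A.1 ht hd, hNA, zero_smul]
  have hNAN' : N * A⁻¹.1 * N = 0 := by
    rw [Matrix.mul_mul_self_eq_trace_smul_of_nilpotent N _ ht hd, adj, mul_sub, Matrix.trace_sub,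
      hNA, mul_smul_comm, mul_one, Matrix.trace_smul, ht]
    simp
  have hA1 : A.1 * A⁻¹.1 = 1 := by
    rw [← Matrix.SpecialLinearGroup.coe_mul, mul_inv_cancel]; rfl
  have hC1 : C.1 = 1 + N := by rw [hN]; abel
  have hconj : (A * C * A⁻¹).1 = 1 + A.1 * N * A⁻¹.1 := by
    rw [Matrix.SpecialLinearGroup.coe_mul, Matrix.SpecialLinearGroup.coe_mul, hC1, mul_add, add_mul,
      mul_one, hA1]
  apply Subtype.ext
  rw [Matrix.SpecialLinearGroup.coe_mul, Matrix.SpecialLinearGroup.coe_mul (A * C * A⁻¹), hconj,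
    hC1]
  have e1 : N * (A.1 * N * A⁻¹.1) = 0 := by
    rw [← mul_assoc, ← mul_assoc, hNAN, zero_mul]
  have e2 : A.1 * N * A⁻¹.1 * N = 0 := by
    rw [mul_assoc, mul_assoc, ← mul_assoc N, hNAN', mul_zero]
  simp only [add_mul, mul_add, one_mul, mul_one, e1, e2, add_zero]
  abel

/-! ### The action on the hyperbolic plane -/

theorem moebius_mk (A : Matrix.SpecialLinearGroup (Fin 2) ℝ) (z : ℍ) :
    moebius (A : PSL2R) z = A • z := rfl

theorem moebius_one (z : ℍ) : moebius 1 z = z := by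
  rw [moebius, map_one, one_smul]

theorem moebius_mul (γ δ : PSL2R) (z : ℍ) : moebius (γ * δ) z = moebius γ (moebius δ z) := by
  rw [moebius, map_mul, mul_smul]; rfl

theorem continuous_sl_smul (A : Matrix.SpecialLinearGroup (Fin 2) ℝ) :
    Continuous fun z : ℍ => A • z :=
  continuous_const_smul (A : GL (Fin 2) ℝ)

theorem continuous_moebius (γ : PSL2R) : Continuous (moebius γ) := by
  obtain ⟨A, rfl⟩ := QuotientGroup.mk_surjective γ
  exact continuous_sl_smul A

theorem sl_mk_eq_one_of_forall_smul_eq (A : Matrix.SpecialLinearGroup (Fin 2) ℝ)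
    (h : ∀ z : ℍ, A • z = z) : (A : PSL2R) = 1 := by
  rw [QuotientGroup.eq_one_iff, Subgroup.mem_center_iff]
  intro B
  have h1 : (A : GL (Fin 2) ℝ) ∈ Subgroup.center _ :=
    UpperHalfPlane.forall_smul_eq_self_iff_mem_center.1 h
  have h2 := Subgroup.mem_center_iff.1 h1 (B : GL (Fin 2) ℝ)
  rw [← map_mul, ← map_mul] at h2
  exact Matrix.SpecialLinearGroup.toGL_injective h2

theorem eq_one_of_forall_moebius_eq (γ : PSL2R) (h : ∀ z, moebius γ z = z) : γ = 1 := by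
  obtain ⟨A, rfl⟩ := QuotientGroup.mk_surjective γ
  exact sl_mk_eq_one_of_forall_smul_eq A h

/-- The matrix `(1 t; 0 1)`. -/
def upperUnipotent (t : ℝ) : Matrix.SpecialLinearGroup (Fin 2) ℝ :=
  ⟨!![1, t; 0, 1], by simp [Matrix.det_fin_two]⟩

theorem upperUnipotent_smul (t : ℝ) (z : ℍ) : upperUnipotent t • z = t +ᵥ z := by
  ext
  rw [UpperHalfPlane.coe_specialLinearGroup_apply]
  simp [upperUnipotent, add_comm]

theorem eq_mk_conj_upperUnipotent {M : Matrix.SpecialLinearGroup (Fin 2) ℝ} {γ : PSL2R} {t : ℝ}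
    (h : ∀ z : ℍ, M⁻¹ • moebius γ z = t +ᵥ (M⁻¹ • z)) :
    γ = ((M * upperUnipotent t * M⁻¹ : Matrix.SpecialLinearGroup (Fin 2) ℝ) : PSL2R) := by
  rw [← inv_mul_eq_one]
  apply eq_one_of_forall_moebius_eq
  intro z
  rw [moebius_mul, moebius_mk, mul_smul, mul_smul, upperUnipotent_smul, ← h, smul_inv_smul,
    ← moebius_mul, inv_mul_cancel, moebius_one]

/-! ### Deck transformations and the cusp. -/

section Holonomy

variable {p : ℍ → PuncturedTorus} {ρ : F2 →* PSL2R}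

/-- The deck transformation and the identity are both lifts of p, and ℍ is connected, so agreeing at
one point they coincide. -/
theorem IsCuspedTorusHolonomy.eq_one_of_moebius_eq (h : IsCuspedTorusHolonomy p ρ) {g : F2} {z : ℍ}
    (hz : moebius (ρ g) z = z) : g = 1 := by
  apply h.injective
  rw [map_one]
  apply eq_one_of_forall_moebius_eq
  have hcomp : p ∘ moebius (ρ g) = p ∘ id := by
    ext1 w
    exact ((h.fiber w _).2 ⟨g, rfl⟩).symm
  have := h.covering.eq_of_comp_eq (continuous_moebius (ρ g)) continuous_id hcomp z hz
  exact congrFun this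

theorem IsCuspedTorusHolonomy.four_le_trace_sq (h : IsCuspedTorusHolonomy p ρ) {g : F2}
    (hg : g ≠ 1) {A : Matrix.SpecialLinearGroup (Fin 2) ℝ} (hA : ρ g = (A : PSL2R)) :
    4 ≤ A.1.trace ^ 2 := by
  by_contra hlt
  have hell : (A : GL (Fin 2) ℝ).IsElliptic := by
    have hdet := A.2
    change A.1.discr < 0
    rw [Matrix.discr_fin_two, hdet]
    linarith
  have hpos : 0 < (A : GL (Fin 2) ℝ).val.det := by
    change 0 < A.1.det
    rw [A.2]; exact one_pos
  have hfix := (UpperHalfPlane.gl_smul_eq_self_iff_eq_fixedPt hpos hell).2 rfl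
  refine hg (h.eq_one_of_moebius_eq (z := UpperHalfPlane.fixedPt _ hell) ?_)
  rw [hA]
  exact hfix

theorem isOpen_horoball (M : Matrix.SpecialLinearGroup (Fin 2) ℝ) : IsOpen (horoball M) :=
  isOpen_lt continuous_const (UpperHalfPlane.continuous_im.comp (continuous_sl_smul M⁻¹))

theorem mem_horoball_of_translation {M : Matrix.SpecialLinearGroup (Fin 2) ℝ} {γ : PSL2R} {t : ℝ}
    (h : ∀ z : ℍ, M⁻¹ • moebius γ z = t +ᵥ (M⁻¹ • z)) {z : ℍ} (hz : z ∈ horoball M) :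
    moebius γ z ∈ horoball M := by
  change 1 < (M⁻¹ • moebius γ z).im
  rw [h, UpperHalfPlane.vadd_im]
  exact hz

/-- The preimage of the cusp neighbourhood is a union of translates of one horoball, any two equal
or disjoint. The peripheral path stays in this preimage, so by connectedness in a single translate.
Both its ends lie there, so a conjugate of [a, b] returns a point of the horoball to it. -/
theorem IsCuspedTorusHolonomy.exists_conj_translation (h : IsCuspedTorusHolonomy p ρ) :
    ∃ (M : Matrix.SpecialLinearGroup (Fin 2) ℝ) (g : F2) (t : ℝ),
      ∀ z : ℍ, M⁻¹ • moebius (ρ (g * commF2 genA genB * g⁻¹)) z = t +ᵥ (M⁻¹ • z) := by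
  obtain ⟨M, U, hU, hV, htrans⟩ := h.cusp
  obtain ⟨z, hz⟩ := h.peripheral U hU
  obtain ⟨g, hg⟩ := (hV z).1 hz.source_mem
  obtain ⟨γ, hγ⟩ := hz
  -- `R k` says that the translates of the horoball by g⁻¹ and k⁻¹ meet. Then u is the translate
  -- containing z and v the union of those disjoint from it.
  let R : F2 → Prop := fun k => ∃ w ∈ horoball M, moebius (ρ (k * g⁻¹)) w ∈ horoball M
  let u : Set ℍ := {w | moebius (ρ g) w ∈ horoball M}
  let v : Set ℍ := ⋃ k ∈ {k | ¬ R k}, {w | moebius (ρ k) w ∈ horoball M}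
  have hop : ∀ k : F2, IsOpen {w | moebius (ρ k) w ∈ horoball M} := fun k =>
    (isOpen_horoball M).preimage (continuous_moebius (ρ k))
  have hmul : ∀ (k : F2) (w : ℍ), moebius (ρ (k * g⁻¹)) (moebius (ρ g) w) = moebius (ρ k) w := by
    intro k w
    rw [← moebius_mul, ← map_mul, inv_mul_cancel_right]
  have hdisj : Disjoint u v := by
    rw [Set.disjoint_left]
    intro w hwu hwv
    simp only [v, Set.mem_iUnion] at hwv
    obtain ⟨k, hk, hwk⟩ := hwv
    exact hk ⟨_, hwu, by rw [hmul]; exact hwk⟩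
  have hcover : Set.range γ ⊆ u ∪ v := by
    rintro _ ⟨s, rfl⟩
    obtain ⟨k, hk⟩ := (hV _).1 (hγ s)
    by_cases hR : R k
    · left
      obtain ⟨w, hw, hw'⟩ := hR
      have hR' : ∃ w ∈ horoball M, moebius (ρ (g * k⁻¹)) w ∈ horoball M := by
        refine ⟨_, hw', ?_⟩
        rw [← moebius_mul, ← map_mul]
        simpa [moebius_one] using hw
      obtain ⟨t, ht⟩ := htrans _ hR'
      have := mem_horoball_of_translation ht hk
      rwa [← moebius_mul, ← map_mul, inv_mul_cancel_right] at this
    · right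
      exact Set.mem_biUnion (show k ∈ {k | ¬ R k} from hR) hk
  have hsub : Set.range γ ⊆ u :=
    (isPreconnected_range γ.continuous).subset_left_of_subset_union (hop g)
      (isOpen_biUnion fun k _ => hop k) hdisj hcover ⟨z, ⟨0, γ.source⟩, hg⟩
  have hend : moebius (ρ g) (moebius (ρ (commF2 genA genB)) z) ∈ horoball M :=
    hsub ⟨1, γ.target⟩
  obtain ⟨t, ht⟩ := htrans (g * commF2 genA genB * g⁻¹) ⟨_, hg, by
    rw [hmul, map_mul, moebius_mul]; exact hend⟩
  exact ⟨M, g, t, ht⟩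

theorem IsCuspedTorusHolonomy.exists_eq_parabolic (h : IsCuspedTorusHolonomy p ρ) :
    ∃ (K : Matrix.SpecialLinearGroup (Fin 2) ℝ) (t : ℝ), t ≠ 0 ∧ ρ (commF2 genA genB) =
      ((K * upperUnipotent t * K⁻¹ : Matrix.SpecialLinearGroup (Fin 2) ℝ) : PSL2R) := by
  obtain ⟨M, g, t, ht⟩ := h.exists_conj_translation
  have h1 := eq_mk_conj_upperUnipotent ht
  obtain ⟨G, hG⟩ := QuotientGroup.mk_surjective (ρ g)
  have h2 : ρ (commF2 genA genB) =
      ((G⁻¹ * M * upperUnipotent t * (G⁻¹ * M)⁻¹ : Matrix.SpecialLinearGroup (Fin 2) ℝ) :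
        PSL2R) := by
    have h3 : G⁻¹ * M * upperUnipotent t * (G⁻¹ * M)⁻¹ =
      G⁻¹ * (M * upperUnipotent t * M⁻¹) * G := by group
    rw [h3, QuotientGroup.mk_mul, QuotientGroup.mk_mul, ← h1, QuotientGroup.mk_inv, hG, map_mul,
      map_mul, map_inv]
    group
  refine ⟨G⁻¹ * M, t, ?_, h2⟩
  rintro rfl
  apply commF2_gen_ne_one
  apply h.injective
  have h0 : upperUnipotent 0 = 1 := by
    ext i j
    fin_cases i <;> fin_cases j <;> simp [upperUnipotent]
  rw [h2, h0, mul_one, mul_inv_cancel, map_one, QuotientGroup.mk_one]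

end Holonomy

/-! ### Fixed points of parabolics, and the sign ambiguity of matrices. -/

theorem upperUnipotent_smul_eq_iff {t : ℝ} (ht : t ≠ 0) (η : ℙ ℝ (Fin 2 → ℝ)) :
    upperUnipotent t • η = η ↔ η = coverRP1 0 := by
  induction η using Projectivization.ind with
  | _ v hv =>
    rw [coverRP1_eq_mk, Projectivization.smul_mk, Projectivization.mk_eq_mk_iff',
      Projectivization.mk_eq_mk_iff']
    have hs : upperUnipotent t • v = ![v 0 + t * v 1, v 1] := by
      change (upperUnipotent t).1.mulVec v = _
      ext i
      fin_cases i <;> simp [upperUnipotent, Matrix.mulVec, dotProduct, Fin.sum_univ_two]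
    have ha : angleVec 0 = ![1, 0] := by simp [angleVec]
    rw [hs, ha]
    constructor
    · rintro ⟨k, hk⟩
      have h0 : k * v 0 = v 0 + t * v 1 := congrFun hk 0
      have h1 : k * v 1 = v 1 := congrFun hk 1
      have hv1 : v 1 = 0 := by
        by_contra hne
        have hk1 : k = 1 := by
          apply mul_right_cancel₀ hne
          rw [h1, one_mul]
        rw [hk1, one_mul] at h0
        exact mul_ne_zero ht hne (by linarith)
      refine ⟨v 0, ?_⟩
      ext i
      fin_cases i <;> simp [hv1]
    · rintro ⟨k, rfl⟩
      refine ⟨1, ?_⟩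
      ext i
      fin_cases i <;> simp

theorem conj_upperUnipotent_smul_eq_iff {t : ℝ} (ht : t ≠ 0)
    (K : Matrix.SpecialLinearGroup (Fin 2) ℝ) (η : ℙ ℝ (Fin 2 → ℝ)) :
    (((K * upperUnipotent t * K⁻¹ : Matrix.SpecialLinearGroup (Fin 2) ℝ)) : PSL2R) • η = η ↔
      η = K • coverRP1 0 := by
  rw [Matrix.ProjectiveSpecialLinearGroup.smul_proj_mk, mul_smul, mul_smul, smul_eq_iff_eq_inv_smul,
    upperUnipotent_smul_eq_iff ht, inv_smul_eq_iff]

theorem sl_mk_eq_mk {A B : Matrix.SpecialLinearGroup (Fin 2) ℝ}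
    (h : (A : PSL2R) = (B : PSL2R)) : B = A ∨ B = -A := by
  rw [QuotientGroup.eq, Matrix.SpecialLinearGroup.mem_center_iff] at h
  obtain ⟨r, hr, hs⟩ := h
  rw [Fintype.card_fin] at hr
  rcases (by simpa using hr : r = 1 ∨ r = -1) with rfl | rfl
  · left
    have h1 : A⁻¹ * B = 1 := Subtype.ext (by rw [← hs, map_one]; rfl)
    rw [inv_mul_eq_one] at h1
    exact h1.symm
  · right
    have h1 : A⁻¹ * B = -1 := Subtype.ext (by rw [← hs, map_neg, map_one]; rfl)
    rw [inv_mul_eq_iff_eq_mul] at h1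
    rw [h1, mul_neg, mul_one]

theorem sl_mk_neg (A : Matrix.SpecialLinearGroup (Fin 2) ℝ) :
    ((-A : Matrix.SpecialLinearGroup (Fin 2) ℝ) : PSL2R) = (A : PSL2R) := by
  rw [eq_comm, QuotientGroup.eq, Matrix.SpecialLinearGroup.mem_center_iff]
  refine ⟨-1, by simp, ?_⟩
  rw [mul_neg, inv_mul_cancel, map_neg, map_one]
  rfl

/-! ### Degree one maps of the line -/

theorem DegOne.map_add_intCast {f : ℝ → ℝ} (hf : StrictMono f) (h1 : ∀ x, f (x + 1) = f x + 1)
    (x : ℝ) (n : ℤ) : f (x + n) = f x + n :=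
  CircleDeg1Lift.map_add_int ⟨⟨f, hf.monotone⟩, h1⟩ x n

/-- Consecutive integer translates of the fixed point y are fixed and enclose x, so they enclose `f
x` too. -/
theorem DegOne.sub_lt_one {f : ℝ → ℝ} (hf : StrictMono f) (h1 : ∀ x, f (x + 1) = f x + 1)
    (hfix : ∃ y, f y = y) (x : ℝ) : x - 1 < f x ∧ f x < x + 1 := by
  obtain ⟨y, hy⟩ := hfix
  have hl : y + ⌊x - y⌋ ≤ x := by linarith [Int.floor_le (x - y)]
  have hr : x < y + (⌊x - y⌋ + 1 : ℤ) := by push_cast; linarith [Int.lt_floor_add_one (x - y)]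
  have hl' := hf.monotone hl
  have hr' := hf hr
  rw [DegOne.map_add_intCast hf h1, hy] at hl' hr'
  push_cast at hr hr'
  constructor <;> linarith

theorem DegOne.exists_fixed_Ioo {f : ℝ → ℝ} (hf : StrictMono f) (h1 : ∀ x, f (x + 1) = f x + 1)
    (hfix : ∃ y, f y = y) {x : ℝ} (hx : f x ≠ x) : ∃ q, x < q ∧ q < x + 1 ∧ f q = q := by
  obtain ⟨y, hy⟩ := hfix
  have hfq : f (y + (-⌊y - x⌋ : ℤ)) = y + (-⌊y - x⌋ : ℤ) := by
    rw [DegOne.map_add_intCast hf h1, hy]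
  refine ⟨_, lt_of_le_of_ne ?_ ?_, ?_, hfq⟩
  · push_cast; linarith [Int.floor_le (y - x)]
  · rintro h
    rw [← h] at hfq
    exact hx hfq
  · push_cast; linarith [Int.lt_floor_add_one (y - x)]

/-! ### Dynamics of the lifted action. -/

section Lift

variable {ρ : F2 →* PSL2R} {τ : F2 →* (ℝ ≃ₜ ℝ)}

theorem IsLiftedAction.exists_coversPos (h : IsLiftedAction ρ τ) (g : F2) :
    ∃ A : Matrix.SpecialLinearGroup (Fin 2) ℝ, ρ g = (A : PSL2R) ∧ CoversPos A (τ g) := by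
  obtain ⟨A, hA⟩ := QuotientGroup.mk_surjective (ρ g)
  rcases exists_coversPos_of_continuous (τ g).continuous A (fun t => by rw [h g t, ← hA])
    with h1 | h1
  · exact ⟨A, hA.symm, h1⟩
  · exact ⟨-A, by rw [sl_mk_neg, hA], h1⟩

theorem IsLiftedAction.strictMono (h : IsLiftedAction ρ τ) (g : F2) : StrictMono (τ g) := by
  obtain ⟨A, -, hA⟩ := h.exists_coversPos g
  exact hA.strictMono (τ g).continuous

theorem IsLiftedAction.map_add_one (h : IsLiftedAction ρ τ) (g : F2) (x : ℝ) :
    τ g (x + 1) = τ g x + 1 := by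
  obtain ⟨A, -, hA⟩ := h.exists_coversPos g
  exact hA.map_add_one (τ g).continuous x

theorem IsLiftedAction.map_add_intCast (h : IsLiftedAction ρ τ) (g : F2) (x : ℝ) (n : ℤ) :
    τ g (x + n) = τ g x + n :=
  DegOne.map_add_intCast (h.strictMono g) (h.map_add_one g) x n

theorem IsLiftedAction.injective (h : IsLiftedAction ρ τ) (hρ : Function.Injective ρ) :
    Function.Injective τ := by
  rw [injective_iff_map_eq_one]
  intro g hg
  apply hρ
  rw [map_one]
  refine FaithfulSMul.eq_of_smul_eq_smul (α := ℙ ℝ (Fin 2 → ℝ)) fun η => ?_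
  obtain ⟨t, rfl⟩ := coverRP1_surjective η
  rw [← h, hg, one_smul]
  rfl

/-- Applying the adjugate of C - r to (C - r)v = 0 gives det(C - r) · v = 0. -/
theorem mulVec_eigenvalue_sq {C : Matrix (Fin 2) (Fin 2) ℝ} {v : Fin 2 → ℝ} (hv : v ≠ 0) {r : ℝ}
    (h : C.mulVec v = r • v) : r ^ 2 - C.trace * r + C.det = 0 := by
  have h0 := congrFun h 0
  have h1 := congrFun h 1
  simp only [Matrix.mulVec, dotProduct, Fin.sum_univ_two, Pi.smul_apply, smul_eq_mul] at h0 h1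
  rw [Matrix.trace_fin_two, Matrix.det_fin_two]
  by_contra hne
  apply hv
  ext i
  fin_cases i
  · refine (mul_eq_zero.1 ?_).resolve_left hne
    simp only [Fin.zero_eta]
    linear_combination (C 1 1 - r) * h0 - C 0 1 * h1
  · refine (mul_eq_zero.1 ?_).resolve_left hne
    simp only [Fin.mk_one]
    linear_combination (C 0 0 - r) * h1 - C 1 0 * h0

theorem coversPos_homeomorph_inv {A : Matrix.SpecialLinearGroup (Fin 2) ℝ} {f : ℝ ≃ₜ ℝ}
    (hA : CoversPos A f) : CoversPos A⁻¹ (f⁻¹ : ℝ ≃ₜ ℝ) :=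
  CoversPos.symm (f := f.toEquiv) hA

/-- The sign choices for A and B cancel in the commutator, so [A, B] is the matrix which the lift of
[a, b] covers with positive stretching. A fixed point gives it a positive eigenvalue and so excludes
trace -2. Trace 2 would make [a, b] commute with its conjugate by a. -/
theorem IsLiftedAction.commF2_apply_ne_self {p : ℍ → PuncturedTorus}
    (hρ : IsCuspedTorusHolonomy p ρ) (h : IsLiftedAction ρ τ) (x : ℝ) :
    τ (commF2 genA genB) x ≠ x := by
  intro hx
  obtain ⟨A, hA, hA'⟩ := h.exists_coversPos genA
  obtain ⟨B, hB, hB'⟩ := h.exists_coversPos genB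
  have hC : CoversPos (A * B * A⁻¹ * B⁻¹) (τ (commF2 genA genB)) := by
    rw [commF2, map_mul, map_mul, map_mul, map_inv, map_inv]
    exact ((hA'.mul hB').mul (coversPos_homeomorph_inv hA')).mul (coversPos_homeomorph_inv hB')
  have hC' : ρ (commF2 genA genB) =
      ((A * B * A⁻¹ * B⁻¹ : Matrix.SpecialLinearGroup (Fin 2) ℝ) : PSL2R) := by
    rw [commF2, map_mul, map_mul, map_mul, map_inv, map_inv, hA, hB]
    rfl
  obtain ⟨K, t, -, hK⟩ := hρ.exists_eq_parabolic
  obtain ⟨r, hr0, hr⟩ := hC x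
  rw [hx] at hr
  have hchar := mulVec_eigenvalue_sq (angleVec_ne_zero x) hr
  rw [(A * B * A⁻¹ * B⁻¹).2] at hchar
  have htr : (K * upperUnipotent t * K⁻¹).1.trace = 2 := by
    rw [Matrix.SpecialLinearGroup.coe_mul, Matrix.trace_mul_comm,
      ← Matrix.SpecialLinearGroup.coe_mul, ← mul_assoc, inv_mul_cancel, one_mul,
      Matrix.trace_fin_two]
    simp only [upperUnipotent, Matrix.of_apply, Matrix.cons_val', Matrix.cons_val_zero,
      Matrix.cons_val_one, Matrix.cons_val_fin_one]
    norm_num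
  have htr2 : (A * B * A⁻¹ * B⁻¹).1.trace = 2 := by
    rcases sl_mk_eq_mk (hK.symm.trans hC') with h1 | h1
    · rw [h1, htr]
    -- With trace -2 the eigenvalue equation reads (r + 1)² = 0, impossible for r > 0.
    · rw [h1] at hchar
      have h2 : (-(K * upperUnipotent t * K⁻¹)).1.trace = -2 := by
        rw [← htr, ← Matrix.trace_neg]; rfl
      rw [h2] at hchar
      nlinarith
  have hcomm := Matrix.SpecialLinearGroup.commute_conj_of_trace_commutator_eq_two A B htr2
  apply not_commute_commF2_conj
  apply hρ.injective
  have hcomm' := congrArg (fun M : Matrix.SpecialLinearGroup (Fin 2) ℝ => (M : PSL2R)) hcomm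
  simp only [QuotientGroup.mk_mul _ (A * B * A⁻¹ * B⁻¹),
    QuotientGroup.mk_mul _ _ (A * B * A⁻¹ * B⁻¹),
    QuotientGroup.mk_mul _ _ A⁻¹, QuotientGroup.mk_inv, ← hC', ← hA] at hcomm'
  simpa only [map_mul, map_inv] using hcomm'

theorem exists_isLiftedAction {p : ℍ → PuncturedTorus} (hρ : IsCuspedTorusHolonomy p ρ) :
    ∃ τ : F2 →* (ℝ ≃ₜ ℝ), IsLiftedAction ρ τ ∧ (∃ x, τ genA x = x) ∧ (∃ y, τ genB y = y) := by
  have hgen : ∀ i : Fin 2, ∃ f : ℝ ≃ₜ ℝ,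
      (∀ t, coverRP1 (f t) = ρ (FreeGroup.of i) • coverRP1 t) ∧ ∃ x, f x = x := by
    intro i
    obtain ⟨A, hA⟩ := QuotientGroup.mk_surjective (ρ (FreeGroup.of i))
    have := exists_lift_with_fixedPoint A
      (hρ.four_le_trace_sq (FreeGroup.of_ne_one i) hA.symm)
    rwa [← hA]
  choose f hf hfix using hgen
  refine ⟨FreeGroup.lift f, ?_, ?_, ?_⟩
  · intro g
    induction g using FreeGroup.induction_on with
    | C1 => intro t; rw [map_one, map_one, one_smul]; rfl
    | of i => intro t; rw [FreeGroup.lift_apply_of]; exact hf i t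
    | inv_of i ih =>
      intro t
      rw [map_inv, map_inv, ← inv_smul_eq_iff, inv_inv, ← ih, FreeGroup.lift_apply_of]
      exact congrArg coverRP1 ((f i).apply_symm_apply t)
    | mul g k hg hk =>
      intro t
      rw [map_mul, map_mul, mul_smul, ← hk, ← hg]
      rfl
  · rw [genA, FreeGroup.lift_apply_of]; exact hfix 0
  · rw [genB, FreeGroup.lift_apply_of]; exact hfix 1

theorem hasFixed_conj {g : F2} (hg : ∃ x, τ g x = x) (k : F2) :
    ∃ x, τ (k * g * k⁻¹) x = x := by
  obtain ⟨x, hx⟩ := hg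
  refine ⟨τ k x, ?_⟩
  change (τ (k * g * k⁻¹) * τ k) x = _
  rw [← map_mul, inv_mul_cancel_right, map_mul]
  exact congrArg (τ k) hx

theorem hasFixed_inv {g : F2} (hg : ∃ x, τ g x = x) : ∃ x, τ g⁻¹ x = x := by
  obtain ⟨x, hx⟩ := hg
  refine ⟨x, ?_⟩
  rw [map_inv]
  exact (τ g).injective (by rw [hx]; exact (τ g).apply_symm_apply x)

theorem IsLiftedAction.sub_lt_one (h : IsLiftedAction ρ τ) {g : F2} (hg : ∃ x, τ g x = x) (x : ℝ) :
    x - 1 < τ g x ∧ τ g x < x + 1 :=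
  DegOne.sub_lt_one (h.strictMono g) (h.map_add_one g) hg x

/-- [u, v] = u · (v u v⁻¹)⁻¹, and each factor has a fixed point, so each moves points by less than
1. -/
theorem IsLiftedAction.commF2_sub_lt_two (h : IsLiftedAction ρ τ) {u v : F2}
    (hu : ∃ x, τ u x = x) (x : ℝ) :
    x - 2 < τ (commF2 u v) x ∧ τ (commF2 u v) x < x + 2 := by
  have h1 := h.sub_lt_one (hasFixed_inv (hasFixed_conj hu v)) x
  have h2 := h.sub_lt_one hu (τ (v * u * v⁻¹)⁻¹ x)
  have h3 : τ (commF2 u v) x = τ u (τ (v * u * v⁻¹)⁻¹ x) := by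
    change _ = (τ u * τ (v * u * v⁻¹)⁻¹) x
    rw [← map_mul, commF2]
    congr 2
    group
  rw [h3]
  constructor <;> linarith [h1.1, h1.2, h2.1, h2.2]

/-- If u fixed x, cancelling u in [u, v]x = x + 1 = u(x + 1) would give (v u v⁻¹)⁻¹x = x + 1, too
far for a map with a fixed point. -/
theorem IsLiftedAction.left_apply_ne_self (h : IsLiftedAction ρ τ) {u v : F2}
    (hu : ∃ x, τ u x = x) {x : ℝ} (hc : τ (commF2 u v) x = x + 1) : τ u x ≠ x := by
  intro hux
  have h1 := (h.sub_lt_one (hasFixed_inv (hasFixed_conj hu v)) x).2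
  have h2 : τ u (τ (v * u * v⁻¹)⁻¹ x) = τ u (x + 1) := by
    rw [h.map_add_one, hux, ← hc]
    change (τ u * τ (v * u * v⁻¹)⁻¹) x = _
    rw [← map_mul, commF2]
    congr 2
    group
  have h3 := (τ u).injective h2
  linarith

/-- If v fixed x, then u v u⁻¹ = [u, v]v would send x to x + 1, too far for a map with a fixed
point. -/
theorem IsLiftedAction.right_apply_ne_self (h : IsLiftedAction ρ τ) {u v : F2}
    (hv : ∃ x, τ v x = x) {x : ℝ} (hc : τ (commF2 u v) x = x + 1) : τ v x ≠ x := by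
  intro hvx
  have h1 := (h.sub_lt_one (hasFixed_conj hv u) x).2
  have h2 : τ (u * v * u⁻¹) x = x + 1 := by
    rw [← hc]
    conv_lhs => rw [← hvx]
    have h3 : u * v * u⁻¹ = commF2 u v * v := by rw [commF2]; group
    rw [h3, map_mul]
    change τ (commF2 u v) (τ v (τ v x)) = _
    rw [hvx, hvx]
  linarith

theorem IsLiftedAction.pow_apply (h : IsLiftedAction ρ τ) {c : F2} {x : ℝ} (hc : τ c x = x + 1)
    (n : ℕ) : τ (c ^ n) x = x + n := by
  induction n with
  | zero => simp
  | succ n ih =>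
    rw [pow_succ, map_mul]
    change τ (c ^ n) (τ c x) = _
    rw [hc, h.map_add_one, ih]
    push_cast; ring

/-- Comparison with the largest translate x + k ≤ z, which goes to x + k + n; the loss z - (x + k)
is less than 1. -/
theorem IsLiftedAction.lt_pow_apply (h : IsLiftedAction ρ τ) {c : F2} {x : ℝ}
    (hc : τ c x = x + 1) (z : ℝ) (n : ℕ) : z + n - 1 < τ (c ^ n) z := by
  have hl : x + ⌊z - x⌋ ≤ z := by linarith [Int.floor_le (z - x)]
  have hl' := (h.strictMono (c ^ n)).monotone hl
  rw [h.map_add_intCast, h.pow_apply hc] at hl'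
  linarith [Int.lt_floor_add_one (z - x)]

end Lift

/-! ### Extending actions from the line to the interval -/

section Extend

variable {j : ℝ → I}

theorem IsInteriorInclusion.pos (hj : IsInteriorInclusion j) (t : ℝ) : 0 < j t :=
  (hj.2.2 ▸ Set.mem_range_self t : j t ∈ Set.Ioo 0 1).1

theorem IsInteriorInclusion.lt_one (hj : IsInteriorInclusion j) (t : ℝ) : j t < 1 :=
  (hj.2.2 ▸ Set.mem_range_self t : j t ∈ Set.Ioo 0 1).2

theorem IsInteriorInclusion.cases (hj : IsInteriorInclusion j) (x : I) :
    x = 0 ∨ x = 1 ∨ ∃ t, j t = x := by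
  rcases (unitInterval.nonneg' : 0 ≤ x).eq_or_lt with h | h
  · exact Or.inl h.symm
  rcases (unitInterval.le_one' : x ≤ 1).eq_or_lt with h' | h'
  · exact Or.inr (Or.inl h')
  · right; right
    have : x ∈ Set.range j := hj.2.2 ▸ ⟨h, h'⟩
    exact this

open Classical in
/-- The extension to `I`, fixing the endpoints, of a map of `ℝ`, the interior of `I`. -/
noncomputable def extendToInterval (j : ℝ → I) (f : ℝ → ℝ) (x : I) : I :=
  if x = 0 then 0 else if x = 1 then 1 else j (f (Function.invFun j x))

@[simp]
theorem extendToInterval_zero (f : ℝ → ℝ) : extendToInterval j f 0 = 0 := by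
  simp [extendToInterval]

@[simp]
theorem extendToInterval_one (f : ℝ → ℝ) : extendToInterval j f 1 = 1 := by
  simp [extendToInterval]

theorem extendToInterval_apply (hj : IsInteriorInclusion j) (f : ℝ → ℝ) (t : ℝ) :
    extendToInterval j f (j t) = j (f t) := by
  rw [extendToInterval, if_neg (hj.pos t).ne', if_neg (hj.lt_one t).ne,
    Function.leftInverse_invFun hj.2.1.injective]

theorem extendToInterval_comp (hj : IsInteriorInclusion j) (f g : ℝ → ℝ) (x : I) :
    extendToInterval j f (extendToInterval j g x) = extendToInterval j (f ∘ g) x := by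
  rcases hj.cases x with rfl | rfl | ⟨t, rfl⟩
  · simp
  · simp
  · simp only [extendToInterval_apply hj, Function.comp_apply]

theorem extendToInterval_id (hj : IsInteriorInclusion j) (x : I) :
    extendToInterval j id x = x := by
  rcases hj.cases x with rfl | rfl | ⟨t, rfl⟩
  · simp
  · simp
  · simp only [extendToInterval_apply hj, id]

theorem extendToInterval_strictMono (hj : IsInteriorInclusion j) {f : ℝ → ℝ} (hf : StrictMono f) :
    StrictMono (extendToInterval j f) := by
  intro x y hxy
  rcases hj.cases x with rfl | rfl | ⟨s, rfl⟩ <;> rcases hj.cases y with rfl | rfl | ⟨t, rfl⟩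
  · exact absurd hxy (lt_irrefl _)
  · simp
  · rw [extendToInterval_zero, extendToInterval_apply hj]; exact hj.pos _
  · exact absurd hxy unitInterval.nonneg'.not_gt
  · exact absurd hxy (lt_irrefl _)
  · exact absurd hxy (hj.lt_one t).le.not_gt
  · exact absurd hxy (hj.pos s).le.not_gt
  · rw [extendToInterval_one, extendToInterval_apply hj]; exact hj.lt_one _
  · rw [extendToInterval_apply hj, extendToInterval_apply hj]
    exact hj.2.1 (hf (hj.2.1.lt_iff_lt.1 hxy))

/-- The extension to `I` of an increasing homeomorphism of `ℝ`. -/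
noncomputable def extendHomeomorph (hj : IsInteriorInclusion j) (f : ℝ ≃ₜ ℝ) (hf : StrictMono f) :
    I ≃ₜ I :=
  ((extendToInterval_strictMono hj hf).orderIsoOfRightInverse _ (extendToInterval j f.symm)
    fun x => by
      rw [extendToInterval_comp hj, f.self_comp_symm, extendToInterval_id hj]).toHomeomorph

theorem extendHomeomorph_apply (hj : IsInteriorInclusion j) (f : ℝ ≃ₜ ℝ) (hf : StrictMono f)
    (x : I) : extendHomeomorph hj f hf x = extendToInterval j f x := rfl

/-- The extension to `I` of an action on `ℝ` by increasing homeomorphisms. -/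
noncomputable def extendAction {G : Type*} [Group G] (hj : IsInteriorInclusion j)
    (τ : G →* (ℝ ≃ₜ ℝ)) (hτ : ∀ g, StrictMono (τ g)) : G →* (I ≃ₜ I) where
  toFun g := extendHomeomorph hj (τ g) (hτ g)
  map_one' := by
    ext1 x
    rw [extendHomeomorph_apply, map_one]
    exact extendToInterval_id hj x
  map_mul' g h := by
    ext1 x
    rw [extendHomeomorph_apply, map_mul]
    exact (extendToInterval_comp hj (τ g) (τ h) x).symm

theorem extendAction_apply {G : Type*} [Group G] (hj : IsInteriorInclusion j)
    (τ : G →* (ℝ ≃ₜ ℝ)) (hτ : ∀ g, StrictMono (τ g)) (g : G) (t : ℝ) :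
    extendAction hj τ hτ g (j t) = j (τ g t) :=
  extendToInterval_apply hj _ t

theorem extendAction_strictMono {G : Type*} [Group G] (hj : IsInteriorInclusion j)
    (τ : G →* (ℝ ≃ₜ ℝ)) (hτ : ∀ g, StrictMono (τ g)) (g : G) :
    StrictMono (extendAction hj τ hτ g) :=
  extendToInterval_strictMono hj (hτ g)

theorem extendAction_injective {G : Type*} [Group G] (hj : IsInteriorInclusion j)
    (τ : G →* (ℝ ≃ₜ ℝ)) (hτ : ∀ g, StrictMono (τ g)) (hinj : Function.Injective τ) :
    Function.Injective (extendAction hj τ hτ) := by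
  intro g h hgh
  apply hinj
  ext t
  apply hj.2.1.injective
  rw [← extendAction_apply hj τ hτ, hgh, extendAction_apply]

theorem IsInteriorInclusion.tendsto_one (hj : IsInteriorInclusion j) {x : ℕ → ℝ}
    (hx : Filter.Tendsto x Filter.atTop Filter.atTop) :
    Filter.Tendsto (fun n => j (x n)) Filter.atTop (𝓝 1) := by
  rw [tendsto_order]
  refine ⟨fun y hy => ?_, fun y hy => absurd hy (not_lt.2 unitInterval.le_one')⟩
  rcases hj.cases y with rfl | rfl | ⟨t, rfl⟩
  · exact Filter.Eventually.of_forall fun n => hj.pos _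
  · exact absurd hy (lt_irrefl _)
  · filter_upwards [hx.eventually_gt_atTop t] with n hn using hj.2.1 hn

end Extend

/-! ### The obstruction to smoothness -/

/-- A `C¹` map near a fixed point which is a limit of fixed points has a displacement function
with small Lipschitz constant. -/
theorem exists_displacement_lipschitz {f : I → I}
    (hf : ContDiffOn ℝ 1 (Set.IccExtend zero_le_one fun x : I => (f x : ℝ)) (Set.Icc 0 1))
    {e : I} {q : ℕ → I} (hq : Filter.Tendsto q Filter.atTop (𝓝 e)) (hqe : ∀ n, q n ≠ e)
    (hfq : ∀ n, f (q n) = q n) {ε : ℝ} (hε : 0 < ε) :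
    ∃ V ∈ 𝓝 e, ∀ x ∈ V, ∀ y ∈ V,
      |((f x : ℝ) - x) - ((f y : ℝ) - y)| ≤ ε * |(x : ℝ) - y| := by
  set F : ℝ → ℝ := Set.IccExtend zero_le_one fun x : I => (f x : ℝ) with hF
  have hFI : ∀ x : I, F x = f x := fun x => Set.IccExtend_val _ _ x
  have hd : DifferentiableOn ℝ F (Set.Icc 0 1) := hf.differentiableOn one_ne_zero
  have hc : ContinuousOn (derivWithin F (Set.Icc 0 1)) (Set.Icc 0 1) :=
    hf.continuousOn_derivWithin (uniqueDiffOn_Icc zero_lt_one) le_rfl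
  have hqr : Filter.Tendsto (fun n => (q n : ℝ)) Filter.atTop (𝓝 (e : ℝ)) :=
    (continuous_subtype_val.tendsto e).comp hq
  have hFe : F e = e := by
    have h1 : Filter.Tendsto (fun n => F (q n)) Filter.atTop (𝓝 (F e)) :=
      (hd.continuousOn e e.2).tendsto.comp
        (tendsto_nhdsWithin_iff.2 ⟨hqr, Filter.Eventually.of_forall fun n => (q n).2⟩)
    have h2 : (fun n => F (q n)) = fun n => (q n : ℝ) := by
      ext n; rw [hFI, hfq]
    rw [h2] at h1
    exact tendsto_nhds_unique h1 hqr
  -- Between fixed points all slopes are 1, so the derivative at their limit is 1.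
  have hder : derivWithin F (Set.Icc 0 1) e = 1 := by
    have h1 := (hasDerivWithinAt_iff_tendsto_slope.1 (hd e e.2).hasDerivWithinAt).comp
      (tendsto_nhdsWithin_iff.2 ⟨hqr, Filter.Eventually.of_forall fun n =>
        ⟨(q n).2, fun h => hqe n (Subtype.ext h)⟩⟩)
    have h2 : (slope F e ∘ fun n => (q n : ℝ)) = fun _ => 1 := by
      ext n
      rw [Function.comp_apply, slope_def_field, hFI, hfq, hFe, div_self]
      exact sub_ne_zero.2 fun h => hqe n (Subtype.ext h)
    rw [h2] at h1
    exact tendsto_nhds_unique h1 tendsto_const_nhds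
  obtain ⟨δ, hδ, hδ'⟩ := Metric.continuousWithinAt_iff.1 (hc e e.2) ε hε
  refine ⟨Metric.ball e δ, Metric.ball_mem_nhds e hδ, fun x hx y hy => ?_⟩
  have hconv : Convex ℝ (Set.Icc (0 : ℝ) 1 ∩ Metric.ball (e : ℝ) δ) :=
    (convex_Icc 0 1).inter (convex_ball _ _)
  have hG : ∀ z ∈ Set.Icc (0 : ℝ) 1 ∩ Metric.ball (e : ℝ) δ,
      HasDerivWithinAt (fun z => F z - z) (derivWithin F (Set.Icc 0 1) z - 1)
        (Set.Icc (0 : ℝ) 1 ∩ Metric.ball (e : ℝ) δ) z := fun z hz =>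
    (((hd z hz.1).hasDerivWithinAt).sub (hasDerivWithinAt_id _ _)).mono Set.inter_subset_left
  have hbd : ∀ z ∈ Set.Icc (0 : ℝ) 1 ∩ Metric.ball (e : ℝ) δ,
      ‖derivWithin F (Set.Icc 0 1) z - 1‖ ≤ ε := fun z hz => by
    have := hδ' hz.1 hz.2
    rw [hder, dist_eq_norm] at this
    exact this.le
  have := hconv.norm_image_sub_le_of_norm_hasDerivWithin_le hG hbd ⟨y.2, hy⟩ ⟨x.2, hx⟩
  simpa only [hFI, Real.norm_eq_abs] using this

/-- If the displacements of `f` and `g` have small Lipschitz constant, then the displacement of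
`f g f⁻¹ g⁻¹` at `u = g f x` is small compared with those of `f` and `g` at `u`. -/
theorem abs_commutator_displacement_le {x fx gx fgx u fu gu : ℝ}
    (h1 : |(fgx - gx) - (fx - x)| ≤ 1 / 32 * |gx - x|)
    (h2 : |(u - fx) - (gx - x)| ≤ 1 / 32 * |fx - x|)
    (h3 : |(fu - u) - (fx - x)| ≤ 1 / 32 * |u - x|)
    (h4 : |(gu - u) - (gx - x)| ≤ 1 / 32 * |u - x|) :
    |fgx - u| ≤ 1 / 16 * (|fu - u| + |gu - u|) := by
  have e1 : |fgx - u| ≤ |(fgx - gx) - (fx - x)| + |(u - fx) - (gx - x)| := by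
    rw [show fgx - u = ((fgx - gx) - (fx - x)) - ((u - fx) - (gx - x)) by ring]
    exact abs_sub _ _
  have e2 : |u - x| ≤ |(u - fx) - (gx - x)| + |gx - x| + |fx - x| := by
    rw [show u - x = ((u - fx) - (gx - x)) + (gx - x) + (fx - x) by ring]
    exact abs_add_three _ _ _
  have e3 : |fx - x| ≤ |(fu - u) - (fx - x)| + |fu - u| := by
    have := abs_sub_abs_le_abs_sub (fx - x) (fu - u)
    rw [abs_sub_comm (fx - x)] at this
    linarith
  have e4 : |gx - x| ≤ |(gu - u) - (gx - x)| + |gu - u| := by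
    have := abs_sub_abs_le_abs_sub (gx - x) (gu - u)
    rw [abs_sub_comm (gx - x)] at this
    linarith
  -- Let S and D be the sums of the displacements of f and g at x and at u. Then |u - x| ≤ (33/32)S
  -- and S ≤ D + |u - x|/16 give S ≤ 2D, while the left side is at most S/32.
  linarith [abs_nonneg (fu - u), abs_nonneg (gu - u), abs_nonneg (fx - x), abs_nonneg (gx - x)]

theorem abs_displacement_le_of_inv {x ix fx : ℝ}
    (h : |(fx - x) - (x - ix)| ≤ 1 / 32 * |x - ix|) :
    |fx - x| ≤ 33 / 32 * |ix - x| := by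
  have e : |fx - x| ≤ |(fx - x) - (x - ix)| + |x - ix| := by
    conv_lhs => rw [show fx - x = ((fx - x) - (x - ix)) + (x - ix) by ring]
    exact abs_add_le _ _
  rw [abs_sub_comm ix x]
  linarith

/-- Near a common fixed point at which two homeomorphisms have displacements with small Lipschitz
constant, the square of their commutator cannot move points at least as far as both do. -/
theorem eventually_commutator_sq_eq {f g c : I ≃ₜ I} (hc : c = f * g * f⁻¹ * g⁻¹) {e : I}
    (hfe : f e = e) (hge : g e = e) {V : Set I} (hV : V ∈ 𝓝 e)
    (hfV : ∀ x ∈ V, ∀ y ∈ V, |((f x : ℝ) - x) - ((f y : ℝ) - y)| ≤ 1 / 32 * |(x : ℝ) - y|)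
    (hgV : ∀ x ∈ V, ∀ y ∈ V, |((g x : ℝ) - x) - ((g y : ℝ) - y)| ≤ 1 / 32 * |(x : ℝ) - y|) :
    ∀ᶠ u in 𝓝 e,
      (|(f u : ℝ) - u| ≤ |(c (c u) : ℝ) - u| ∨ |(f⁻¹ u : ℝ) - u| ≤ |(c (c u) : ℝ) - u|) →
      (|(g u : ℝ) - u| ≤ |(c (c u) : ℝ) - u| ∨ |(g⁻¹ u : ℝ) - u| ≤ |(c (c u) : ℝ) - u|) →
      c (c u) = u := by
  have hfi : ∀ x, f (f⁻¹ x) = x := f.apply_symm_apply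
  have hgi : ∀ x, g (g⁻¹ x) = x := g.apply_symm_apply
  have hfie : f⁻¹ e = e := f.injective (by rw [hfi, hfe])
  have hgie : g⁻¹ e = e := g.injective (by rw [hgi, hge])
  have hcu : ∀ u, c u = f (g (f⁻¹ (g⁻¹ u))) := fun u => by rw [hc]; rfl
  have hce : c e = e := by rw [hcu, hgie, hfie, hge, hfe]
  have ev : ∀ w : I → I, Continuous w → w e = e → ∀ᶠ u in 𝓝 e, w u ∈ V := fun w hw hwe =>
    hw.continuousAt (by rwa [hwe])
  have step : ∀ᶠ u in 𝓝 e, u ∈ V ∧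
      |(c u : ℝ) - u| ≤ 1 / 16 * (|(f u : ℝ) - u| + |(g u : ℝ) - u|) := by
    -- The base point is x = f⁻¹g⁻¹u, so that u = gfx and cu = fgx.
    filter_upwards [hV, ev (fun u => f⁻¹ (g⁻¹ u)) (f⁻¹.continuous.comp g⁻¹.continuous)
        (by simp only [hgie, hfie]),
      ev (fun u => g⁻¹ u) g⁻¹.continuous hgie,
      ev (fun u => g (f⁻¹ (g⁻¹ u))) (g.continuous.comp (f⁻¹.continuous.comp g⁻¹.continuous))
        (by simp only [hgie, hfie, hge])] with u hu hx hfx hgx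
    refine ⟨hu, ?_⟩
    rw [hcu]
    have e1 := hfV _ hgx _ hx
    have e2 := hgV _ hfx _ hx
    have e3 := hfV _ hu _ hx
    have e4 := hgV _ hu _ hx
    rw [hfi] at e1 e3
    rw [hgi] at e2
    exact abs_commutator_displacement_le e1 e2 e3 e4
  have step' : ∀ᶠ u in 𝓝 e, c u ∈ V ∧
      |(c (c u) : ℝ) - c u| ≤ 1 / 16 * (|(f (c u) : ℝ) - c u| + |(g (c u) : ℝ) - c u|) := by
    have ht : Filter.Tendsto c (𝓝 e) (𝓝 e) := by
      have := c.continuous.tendsto e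
      rwa [hce] at this
    exact ht.eventually step
  filter_upwards [step, step', ev _ f⁻¹.continuous hfie, ev _ g⁻¹.continuous hgie]
    with u ⟨hu, h1⟩ ⟨hcuV, h2⟩ hfu hgu hf hg
  have e1 := hfV _ hcuV _ hu
  have e2 := hgV _ hcuV _ hu
  have e3 := hfV _ hu _ hfu
  have e4 := hgV _ hu _ hgu
  rw [hfi] at e3
  rw [hgi] at e4
  have e3' := abs_displacement_le_of_inv e3
  have e4' := abs_displacement_le_of_inv e4
  have t1 := abs_sub_abs_le_abs_sub ((f (c u) : ℝ) - c u) ((f u : ℝ) - u)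
  have t2 := abs_sub_abs_le_abs_sub ((g (c u) : ℝ) - c u) ((g u : ℝ) - u)
  have t3 := abs_sub_le (c (c u) : ℝ) (c u) u
  have hF : |(f u : ℝ) - u| ≤ 33 / 32 * |(c (c u) : ℝ) - u| := by
    rcases hf with hf | hf <;> linarith [abs_nonneg ((c (c u) : ℝ) - u)]
  have hG : |(g u : ℝ) - u| ≤ 33 / 32 * |(c (c u) : ℝ) - u| := by
    rcases hg with hg | hg <;> linarith [abs_nonneg ((c (c u) : ℝ) - u)]
  -- With m = |c²u - u|, the displacements of f and g at u are at most (33/32)m, so both steps u ↦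
  -- cu ↦ c²u are small multiples of m. Their sum is less than m/2 + m/2 unless m = 0.
  have hz : |(c (c u) : ℝ) - u| = 0 := by
    linarith [abs_nonneg ((c (c u) : ℝ) - u), abs_nonneg ((f u : ℝ) - u),
      abs_nonneg ((g u : ℝ) - u)]
  exact Subtype.ext (sub_eq_zero.1 (abs_eq_zero.1 hz))

/-- Betweenness, unlike distance, survives conjugation, and also when φ reverses orientation. -/
theorem Homeomorph.abs_sub_le_of_between (φ : I ≃ₜ I) {x y z : I} (hxy : x ≤ y) (hyz : y ≤ z) :
    |(φ y : ℝ) - φ x| ≤ |(φ z : ℝ) - φ x| := by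
  rcases φ.continuous.strictMono_of_inj φ.injective with h | h
  · have h1 : (φ x : ℝ) ≤ φ y := h.monotone hxy
    have h2 : (φ y : ℝ) ≤ φ z := h.monotone hyz
    rw [abs_of_nonneg (by linarith), abs_of_nonneg (by linarith)]
    linarith
  · have h1 : (φ y : ℝ) ≤ φ x := h.antitone hxy
    have h2 : (φ z : ℝ) ≤ φ y := h.antitone hyz
    rw [abs_of_nonpos (by linarith), abs_of_nonpos (by linarith)]
    linarith

/-- A group of homeomorphisms of `I` in which the commutator `c` of `a` and `b` moves points
`u n` near `1` at least half as far as `a` and `b` do is not conjugate into `Diff¹`. -/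
theorem not_isConjIntoDiff1_of_orbitLT {G : Type*} [Group G] {α : G →* (I ≃ₜ I)}
    (hmono : ∀ g, StrictMono (α g)) {a b c : G} (hc : c = a * b * a⁻¹ * b⁻¹) {u q r : ℕ → I}
    (hu : Filter.Tendsto u Filter.atTop (𝓝 1))
    (hq : Filter.Tendsto q Filter.atTop (𝓝 1)) (hq1 : ∀ n, q n ≠ 1) (haq : ∀ n, α a (q n) = q n)
    (hr : Filter.Tendsto r Filter.atTop (𝓝 1)) (hr1 : ∀ n, r n ≠ 1) (hbr : ∀ n, α b (r n) = r n)
    (h : ∀ n, u n < α (c ^ 2) (u n) ∧ OrbitLT α (u n) a (c ^ 2) ∧ OrbitLT α (u n) a⁻¹ (c ^ 2) ∧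
      OrbitLT α (u n) b (c ^ 2) ∧ OrbitLT α (u n) b⁻¹ (c ^ 2)) :
    ¬ IsConjIntoDiff1 α := by
  rintro ⟨φ, hφ⟩
  let β : G →* (I ≃ₜ I) := (MulAut.conj φ).toMonoidHom.comp α
  have hβ : ∀ g, β g = φ * α g * φ⁻¹ := fun g => rfl
  have hβφ : ∀ g x, β g (φ x) = φ (α g x) := fun g x => by
    rw [hβ]
    exact congrArg (fun y => φ (α g y)) (φ.symm_apply_apply x)
  have htop : ∀ g, α g 1 = 1 := fun g => by
    obtain ⟨x, hx⟩ := (α g).surjective 1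
    exact le_antisymm unitInterval.le_one'
      (hx.symm.le.trans ((hmono g).monotone unitInterval.le_one'))
  have he : ∀ g, β g (φ 1) = φ 1 := fun g => by rw [hβφ, htop]
  have hφt : Filter.Tendsto φ (𝓝 1) (𝓝 (φ 1)) := φ.continuous.tendsto 1
  have hlip : ∀ g (s : ℕ → I), Filter.Tendsto s Filter.atTop (𝓝 1) → (∀ n, s n ≠ 1) →
      (∀ n, α g (s n) = s n) → ∃ V ∈ 𝓝 (φ 1), ∀ x ∈ V, ∀ y ∈ V,
        |((β g x : ℝ) - x) - ((β g y : ℝ) - y)| ≤ 1 / 32 * |(x : ℝ) - y| := by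
    intro g s hs hs1 hgs
    exact exists_displacement_lipschitz (hφ g).2.1 (hφt.comp hs)
      (fun n hn => hs1 n (φ.injective hn)) (fun n => by rw [Function.comp_apply, ← hβ, hβφ, hgs])
      (by norm_num)
  obtain ⟨V, hV, hVa⟩ := hlip a q hq hq1 haq
  obtain ⟨W, hW, hWb⟩ := hlip b r hr hr1 hbr
  have hev := eventually_commutator_sq_eq (f := β a) (g := β b) (c := β c)
    (by rw [hc]; simp only [map_mul, map_inv]) (he a) (he b) (Filter.inter_mem hV hW)
    (fun x hx y hy => hVa x hx.1 y hy.1) (fun x hx y hy => hWb x hx.2 y hy.2)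
  obtain ⟨n, hn⟩ := ((hφt.comp hu).eventually hev).exists
  obtain ⟨h0, h1, h2, h3, h4⟩ := h n
  have hcc : β c (β c ((φ ∘ u) n)) = φ (α (c ^ 2) (u n)) := by
    rw [Function.comp_apply, hβφ, hβφ, pow_two, map_mul]
    rfl
  rw [hcc] at hn
  have hbetween : ∀ g, α g (u n) < α (c ^ 2) (u n) → α g⁻¹ (u n) < α (c ^ 2) (u n) →
      (|(β g (φ (u n)) : ℝ) - φ (u n)| ≤ |(φ (α (c ^ 2) (u n)) : ℝ) - φ (u n)| ∨
        |((β g)⁻¹ (φ (u n)) : ℝ) - φ (u n)| ≤ |(φ (α (c ^ 2) (u n)) : ℝ) - φ (u n)|) := by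
    intro g hg hg'
    rw [← map_inv, hβφ, hβφ]
    -- Whichever of g and g⁻¹ does not move `u n` down sends it between `u n` and its image under
    -- c².
    rcases le_total (u n) (α g (u n)) with hle | hle
    · exact Or.inl (φ.abs_sub_le_of_between hle hg.le)
    · right
      refine φ.abs_sub_le_of_between ?_ hg'.le
      have := (hmono g⁻¹).monotone hle
      rw [map_inv] at this ⊢
      rwa [show (α g)⁻¹ (α g (u n)) = u n from (α g).symm_apply_apply _] at this
  have := φ.injective (hn (hbetween a h1 h2) (hbetween b h3 h4))
  exact h0.ne' this

/-! ### Assembling the dynamics and the obstruction. -/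

section Main

variable {ρ : F2 →* PSL2R} {τ : F2 →* (ℝ ≃ₜ ℝ)}

theorem IsLiftedAction.generators_apply_ne_self (h : IsLiftedAction ρ τ)
    (ha : ∃ x, τ genA x = x) (hb : ∃ y, τ genB y = y) {c : F2}
    (hc : c = commF2 genA genB ∨ c = commF2 genB genA) {x : ℝ} (hx : τ c x = x + 1) :
    τ genA x ≠ x ∧ τ genB x ≠ x := by
  rcases hc with rfl | rfl
  · exact ⟨h.left_apply_ne_self ha hx, h.right_apply_ne_self hb hx⟩
  · exact ⟨h.right_apply_ne_self ha hx, h.left_apply_ne_self hb hx⟩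

/-- The integer displacement of x under [a, b] lies in (-2, 2) and is not 0. If it is -1, the
inverse [b, a] moves x by 1. -/
theorem IsLiftedAction.exists_commutator_apply_eq_add_one {p : ℍ → PuncturedTorus}
    (hρ : IsCuspedTorusHolonomy p ρ) (h : IsLiftedAction ρ τ) (ha : ∃ x, τ genA x = x) {x : ℝ}
    (hx : ρ (commF2 genA genB) • coverRP1 x = coverRP1 x) :
    ∃ c : F2, (c = commF2 genA genB ∨ c = commF2 genB genA) ∧ τ c x = x + 1 := by
  rw [← h, eq_comm, coverRP1_eq_iff] at hx
  obtain ⟨n, hn⟩ := hx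
  have h1 := h.commF2_sub_lt_two ha (v := genB) x
  have h0 := h.commF2_apply_ne_self hρ x
  rw [hn] at h1 h0
  have hn1 : -2 < n := by
    have : (-2 : ℝ) < n := by linarith [h1.1]
    exact_mod_cast this
  have hn2 : n < 2 := by
    have : (n : ℝ) < 2 := by linarith [h1.2]
    exact_mod_cast this
  have hn0 : n ≠ 0 := fun h => h0 (by simp [h])
  have hn3 : n = 1 ∨ n = -1 := by omega
  rcases hn3 with rfl | rfl
  · exact ⟨_, Or.inl rfl, by simpa using hn⟩
  · refine ⟨_, Or.inr rfl, ?_⟩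
    have hinv : commF2 genB genA = (commF2 genA genB)⁻¹ := by
      simp only [commF2]; group
    have h2 : τ (commF2 genA genB) (x + 1) = x := by
      rw [h.map_add_one, hn]; push_cast; ring
    rw [hinv, map_inv]
    conv_lhs => rw [← h2]
    exact (τ (commF2 genA genB)).symm_apply_apply _

theorem IsLiftedAction.apply_eq_add_one_of_coverRP1_eq (h : IsLiftedAction ρ τ) {c : F2} {x y : ℝ}
    (hx : τ c x = x + 1) (hy : coverRP1 y = coverRP1 x) : τ c y = y + 1 := by
  obtain ⟨n, rfl⟩ := coverRP1_eq_iff.1 hy.symm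
  rw [h.map_add_intCast, hx]; ring

theorem IsLiftedAction.lt_sq_apply (h : IsLiftedAction ρ τ) {c g : F2} {x : ℝ}
    (hx : τ c x = x + 1) (hg : ∃ y, τ g y = y) : τ g x < τ (c ^ 2) x := by
  rw [h.pow_apply hx]
  have := (h.sub_lt_one hg x).2
  push_cast
  linarith

theorem orbitLT_extendAction {j : ℝ → I} (hj : IsInteriorInclusion j)
    (hτ : ∀ g, StrictMono (τ g)) {g k : F2} {t : ℝ} (h : τ g t < τ k t) :
    OrbitLT (extendAction hj τ hτ) (j t) g k := by
  rw [OrbitLT, extendAction_apply, extendAction_apply]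
  exact hj.2.1 h

theorem IsLiftedAction.exists_fixed_sequence (h : IsLiftedAction ρ τ) {g : F2}
    (hg : ∃ y, τ g y = y) {j : ℝ → I} (hj : IsInteriorInclusion j) :
    ∃ q : ℕ → I, Filter.Tendsto q Filter.atTop (𝓝 1) ∧ (∀ n, q n ≠ 1) ∧
      ∀ n, extendAction hj τ h.strictMono g (q n) = q n := by
  obtain ⟨y, hy⟩ := hg
  refine ⟨fun n => j (y + n), ?_, fun n => (hj.lt_one _).ne, fun n => ?_⟩
  · exact hj.tendsto_one (Filter.tendsto_atTop_add_const_left _ _ tendsto_natCast_atTop_atTop)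
  · have := h.map_add_intCast g y n
    rw [hy] at this
    rw [extendAction_apply]
    exact congrArg j (by exact_mod_cast this)

theorem IsLiftedAction.not_isConjIntoDiff1 (h : IsLiftedAction ρ τ) {a b c : F2}
    (hc : c = commF2 a b) (ha : ∃ x, τ a x = x) (hb : ∃ x, τ b x = x) {x : ℝ}
    (hx : τ c x = x + 1) {j : ℝ → I} (hj : IsInteriorInclusion j) :
    ¬ IsConjIntoDiff1 (extendAction hj τ h.strictMono) := by
  obtain ⟨q, hq, hq1, haq⟩ := h.exists_fixed_sequence ha hj
  obtain ⟨r, hr, hr1, hbr⟩ := h.exists_fixed_sequence hb hj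
  have hxn : ∀ n : ℕ, τ c (x + n) = x + n + 1 := fun n =>
    h.apply_eq_add_one_of_coverRP1_eq hx (by exact_mod_cast coverRP1_add_intCast x n)
  refine not_isConjIntoDiff1_of_orbitLT (extendAction_strictMono hj τ h.strictMono) hc
    (u := fun n : ℕ => j (x + n))
    (hj.tendsto_one (Filter.tendsto_atTop_add_const_left _ _ tendsto_natCast_atTop_atTop))
    hq hq1 haq hr hr1 hbr fun n => ⟨?_, ?_, ?_, ?_, ?_⟩
  · rw [extendAction_apply]
    apply hj.2.1
    rw [h.pow_apply (hxn n)]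
    push_cast
    linarith
  · exact orbitLT_extendAction hj _ (h.lt_sq_apply (hxn n) ha)
  · exact orbitLT_extendAction hj _ (h.lt_sq_apply (hxn n) (hasFixed_inv ha))
  · exact orbitLT_extendAction hj _ (h.lt_sq_apply (hxn n) hb)
  · exact orbitLT_extendAction hj _ (h.lt_sq_apply (hxn n) (hasFixed_inv hb))

end Main

theorem mainTheorem2 (p : ℍ → PuncturedTorus) (ρ : F2 →* PSL2R)
    (hρ : IsCuspedTorusHolonomy p ρ) :
    LocallyIndicable F2 ∧
    ∃ ξ : ℙ ℝ (Fin 2 → ℝ), (∀ η : ℙ ℝ (Fin 2 → ℝ), ρ (commF2 genA genB) • η = η ↔ η = ξ) ∧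
    (∃ τ : F2 →* (ℝ ≃ₜ ℝ), IsLiftedAction ρ τ ∧ (∃ x, τ genA x = x) ∧ (∃ y, τ genB y = y)) ∧
    ∀ τ : F2 →* (ℝ ≃ₜ ℝ), IsLiftedAction ρ τ →
      (∃ x, τ genA x = x) → (∃ y, τ genB y = y) →
      (∀ g, StrictMono (τ g)) ∧ (∀ g x, τ g (x + 1) = τ g x + 1) ∧
      ∃ c : F2, (c = commF2 genA genB ∨ c = commF2 genB genA) ∧
        (∀ x, coverRP1 x = ξ → τ c x = x + 1) ∧
        (∀ (z : ℝ) (n : ℕ), 1 ≤ n → z + n - 1 < τ (c ^ n) z) ∧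
        (∀ x, coverRP1 x = ξ →
          (∃ q, x < q ∧ q < x + 1 ∧ τ genA q = q) ∧ (∃ r, x < r ∧ r < x + 1 ∧ τ genB r = r)) ∧
        ∀ j : ℝ → I, IsInteriorInclusion j →
          ∃ α : F2 →* (I ≃ₜ I), (∀ g t, α g (j t) = j (τ g t)) ∧
            (∀ g, StrictMono (α g)) ∧ Function.Injective α ∧
            (∀ x, coverRP1 x = ξ →
              Filter.Tendsto (fun n : ℕ => j (x + n)) Filter.atTop (𝓝 1) ∧
              ∀ n : ℤ, α c (j (x + n)) = j (x + n + 1) ∧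
                OrbitLT α (j (x + n)) genA (c ^ 2) ∧ OrbitLT α (j (x + n)) genA⁻¹ (c ^ 2) ∧
                OrbitLT α (j (x + n)) genB (c ^ 2) ∧ OrbitLT α (j (x + n)) genB⁻¹ (c ^ 2)) ∧
            ¬ IsConjIntoDiff1 α := by
  obtain ⟨K, t, ht, hK⟩ := hρ.exists_eq_parabolic
  have hfix : ∀ η : ℙ ℝ (Fin 2 → ℝ),
      ρ (commF2 genA genB) • η = η ↔ η = K • coverRP1 0 := fun η => by
    rw [hK, conj_upperUnipotent_smul_eq_iff ht]
  refine ⟨locallyIndicable_F2, K • coverRP1 0, hfix, exists_isLiftedAction hρ, ?_⟩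
  obtain ⟨x, hx⟩ := coverRP1_surjective (K • coverRP1 0)
  rw [← hx] at hfix ⊢
  intro τ h ha hb
  refine ⟨h.strictMono, h.map_add_one, ?_⟩
  obtain ⟨c, hc, hcx⟩ := h.exists_commutator_apply_eq_add_one hρ ha ((hfix _).2 rfl)
  have hcy : ∀ y, coverRP1 y = coverRP1 x → τ c y = y + 1 := fun y hy =>
    h.apply_eq_add_one_of_coverRP1_eq hcx hy
  refine ⟨c, hc, hcy, fun z n _ => h.lt_pow_apply hcx z n, fun y hy => ?_, fun j hj => ?_⟩
  · obtain ⟨hya, hyb⟩ := h.generators_apply_ne_self ha hb hc (hcy y hy)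
    exact ⟨DegOne.exists_fixed_Ioo (h.strictMono _) (h.map_add_one _) ha hya,
      DegOne.exists_fixed_Ioo (h.strictMono _) (h.map_add_one _) hb hyb⟩
  · refine ⟨extendAction hj τ h.strictMono, extendAction_apply hj τ h.strictMono,
      extendAction_strictMono hj τ h.strictMono,
      extendAction_injective hj τ h.strictMono (h.injective hρ.injective), fun y hy => ⟨?_, ?_⟩, ?_⟩
    · exact hj.tendsto_one (Filter.tendsto_atTop_add_const_left _ _ tendsto_natCast_atTop_atTop)
    · intro n
      have hyn : τ c (y + n) = y + n + 1 := hcy _ (by rw [coverRP1_add_intCast, hy])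
      refine ⟨by rw [extendAction_apply, hyn], ?_, ?_, ?_, ?_⟩
      · exact orbitLT_extendAction hj _ (h.lt_sq_apply hyn ha)
      · exact orbitLT_extendAction hj _ (h.lt_sq_apply hyn (hasFixed_inv ha))
      · exact orbitLT_extendAction hj _ (h.lt_sq_apply hyn hb)
      · exact orbitLT_extendAction hj _ (h.lt_sq_apply hyn (hasFixed_inv hb))
    -- The obstruction is symmetric in the generators, so c = [b, a] is handled by exchanging their
    -- roles.
    · rcases hc with hc | hc
      · exact h.not_isConjIntoDiff1 hc ha hb hcx hj
      · exact h.not_isConjIntoDiff1 hc hb ha hcx hj
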